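/- Let $k$ be any field (of arbitrary characteristic), let $n\ge 18$, and let $S=k[\alpha_1,\dots,\alpha_n]$, with $S_+=(\alpha_1,\dots,\alpha_n)$. Let $P$ be the associated divided power ring, regarded as an $S$-module: $P$ is the space of $k$-linear functionals $f\colon S\to k$ vanishing on $(S_+)^N$ for all $N\gg 0$, with the contraction action $(s\cdot f)(t)=f(st)$. It has the $k$-basis of divided power monomials $x^{[\mathbf a]}$ dual to the monomials $\alpha^{\mathbf a}$; let $P_3$ be the span of those with $|\mathbf a|=3$. For $f\in P_3$ put $\mathrm{Ann}(f)=\{s\in S : s\cdot f=0\}$, a homogeneous ideal of $S$, and $\mathrm{Apolar}(f)=S/\mathrm{Ann}(f)$. Write $H(M)_i=\dim_k M_i$ for the Hilbert function of a graded module $M$. One says that $\mathrm{Apolar}(f)$ satisfies the *small tangent space condition* if $\mathrm{Apolar}(f)$ has Hilbert function $(1,n,n,1)$ (that is, $H_0=1$, $H_1=n$, $H_2=n$, $H_3=1$ and $H_i=0$ for $i\ge 4$), $H(S/\mathrm{Ann}(f)^2)_4=n$ and $H(S/\mathrm{Ann}(f)^2)_5=0$. **Theorem.** For a general $f\in P_3$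 the algebra $\mathrm{Apolar}(f)$ satisfies the small tangent space condition. Precisely: there is a dense open subset $U$ of the affine space of cubics $\operatorname{Spec}\operatorname{Sym}(P_3)^\vee$ over $k$, containing at least one $k$-rational point, such that for every extension field $K$ of $k$ and every $K$-rational point $f$ of $U$ (that is, every cubic $f$ in the divided power ring in $n$ variables over $K$ whose coefficients define a point of $U$), the algebra $\mathrm{Apolar}(f)$, formed over $K$, satisfies the small tangent space condition. In particular (taking $K=k$) this holds for every cubic $f\in U(k)$, and $U(k)\neq\emptyset$. -/

import Mathlib

universe u

namespace Apolarity

noncomputable section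

open MvPolynomial

/-- The polynomial ring `S = k[α₁, …, αₙ]`. -/
abbrev S (n : ℕ) (k : Type u) [Field k] : Type u := MvPolynomial (Fin n) k

/-- The divided power ring `P` associated to `S`, as the space of those `k`-linear functionals on
`S` which vanish on `(S₊)^N`, `S₊ = (α₁, …, αₙ)`, for all sufficiently large `N` (the powers of `S₊` decrease, so it is
enough that this happens for one `N`). Only its structure of an `S`-module is needed. -/
def P (n : ℕ) (k : Type u) [Field k] : Submodule k (Module.Dual k (S n k)) where
  carrier := {f | ∃ N : ℕ, ∀ s ∈ idealOfVars (Fin n) k ^ N, f s = 0}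
  zero_mem' := ⟨0, fun _ _ => rfl⟩
  add_mem' := by
    rintro f g ⟨N, hN⟩ ⟨M, hM⟩
    refine ⟨N + M, fun s hs => ?_⟩
    rw [LinearMap.add_apply, hN s (Ideal.pow_le_pow_right (Nat.le_add_right N M) hs),
      hM s (Ideal.pow_le_pow_right (Nat.le_add_left M N) hs), add_zero]
  smul_mem' := by
    rintro c f ⟨N, hN⟩
    exact ⟨N, fun s hs => by rw [LinearMap.smul_apply, hN s hs, smul_zero]⟩

variable {n : ℕ} {k : Type u} [Field k]

/-- The divided power monomial `x^[a]`: the functional dual to the monomial `α^a`. -/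
def dpMonomial (a : Fin n →₀ ℕ) : P n k :=
  ⟨lcoeff k a, a.degree + 1, fun s hs =>
    (mem_pow_idealOfVars_iff' (a.degree + 1) s).1 hs a (Nat.lt_succ_self _)⟩

/-- `f ∈ P` is homogeneous of degree `d`. -/
def IsHomogeneousOfDegree (f : P n k) (d : ℕ) : Prop :=
  f ∈ Submodule.span k {g : P n k | ∃ a : Fin n →₀ ℕ, a.degree = d ∧ g = dpMonomial a}

/-- Contraction, the action of `S` on `P` induced from the action on functionals:
`(s · f)(t) = f (s t)`. -/
def contract (s : S n k) (f : P n k) : P n k :=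
  ⟨f.1 ∘ₗ LinearMap.mulLeft k s, by
    obtain ⟨f, N, hN⟩ := f
    exact ⟨N, fun t ht => hN _ (Ideal.mul_mem_left _ s ht)⟩⟩

/-- The apolar ideal `Ann(f) = {s ∈ S : s · f = 0}`. -/
def Ann (f : P n k) : Ideal (S n k) where
  carrier := {s | contract s f = 0}
  zero_mem' := by
    refine Subtype.ext (LinearMap.ext fun t => ?_)
    simp [contract]
  add_mem' := by
    intro s t hs ht
    refine Subtype.ext (LinearMap.ext fun r => ?_)
    have h₁ := LinearMap.congr_fun (congrArg Subtype.val hs) r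
    have h₂ := LinearMap.congr_fun (congrArg Subtype.val ht) r
    simp only [contract, LinearMap.comp_apply, LinearMap.mulLeft_apply, ZeroMemClass.coe_zero,
      LinearMap.zero_apply] at h₁ h₂ ⊢
    rw [add_mul, map_add, h₁, h₂, add_zero]
  smul_mem' := by
    intro c s hs
    refine Subtype.ext (LinearMap.ext fun r => ?_)
    have h := LinearMap.congr_fun (congrArg Subtype.val hs) (c * r)
    simp only [contract, LinearMap.comp_apply, LinearMap.mulLeft_apply, ZeroMemClass.coe_zero,
      LinearMap.zero_apply, smul_eq_mul] at h ⊢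
    rw [← h]
    congr 1
    ring

/-- The apolar algebra `Apolar(f) = S / Ann(f)`. -/
abbrev Apolar (f : P n k) : Type u := S n k ⧸ Ann f

/-- The Hilbert function `H(S/J)` of the graded algebra `S/J`, for a homogeneous ideal `J`: the
degree `i` part of `S/J` is the image of the space of forms of degree `i`. -/
def hilbert (J : Ideal (S n k)) (i : ℕ) : ℕ :=
  Module.finrank k
    ((homogeneousSubmodule (Fin n) k i).map (Ideal.Quotient.mkₐ k J).toLinearMap)

/-- The small tangent space condition for `Apolar(f)`, `f` homogeneous of degree `3`:
its Hilbert function is `(1, n, n, 1)`, and `H(S/Ann(f)²)₄ = n`, `H(S/Ann(f)²)₅ = 0`. -/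
structure SmallTangentSpace (f : P n k) : Prop where
  hilbert_zero : hilbert (Ann f) 0 = 1
  hilbert_one : hilbert (Ann f) 1 = n
  hilbert_two : hilbert (Ann f) 2 = n
  hilbert_three : hilbert (Ann f) 3 = 1
  hilbert_of_four_le : ∀ i, 4 ≤ i → hilbert (Ann f) i = 0
  hilbert_sq_four : hilbert (Ann f ^ 2) 4 = n
  hilbert_sq_five : hilbert (Ann f ^ 2) 5 = 0

/-- The affine space `Spec Sym (P₃)^∨` of cubics. The ring `Sym (P₃)^∨` is the polynomial ring in
the coordinates of `P₃` with respect to its basis `x^[a]`, `|a| = 3`. -/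
abbrev CubicSpace (n : ℕ) (k : Type u) [Field k] : Type u :=
  PrimeSpectrum (MvPolynomial {a : Fin n →₀ ℕ // a.degree = 3} k)

/-- The point of the affine space of cubics over `k` which is the image of the `K`-rational point
given by a cubic `f` over an extension field `K` of `k`, that is, the kernel of the evaluation at
the coefficients of `f`. For `K = k` it is the rational point `f` itself. -/
def cubicPoint (k : Type u) [Field k] {K : Type u} [Field K] [Algebra k K] (f : P n K) :
    CubicSpace n k :=
  ⟨RingHom.ker (aeval (R := k)
      fun a : {a : Fin n →₀ ℕ // a.degree = 3} => f.1 (monomial a.1 (1 : K))),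
    RingHom.ker_isPrime _⟩

end

end Apolarity

/-! Each condition is implied by the non-vanishing of a polynomial in the coefficients of the cubic,
so one good rational cubic suffices. The witness is the circulant cubic f₀ = ∑ xᵢxᵢ₊₁xᵢ₊₃. The
differences ±1, ±2, ±3 of {0, 1, 3} are all distinct, so two adjacent vertices lie in exactly one
triple. Hence Ann(f₀)₂ =: Q contains the products of non-adjacent variables (squares included) and
the differences of two pairs completed to triples by the same vertex. All coefficients are 0 or 1
and the determinants at f₀ equal 1, so the characteristic plays no role.

Lower bound in degree 4: by the Leibniz rule the n functionals s ↦ f(∂ᵤs) vanish on Ann(f)²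
(`apply_pderiv_eq_zero`). For f₀ they are dual to the n quartics x_v·xᵢxᵢ₊₁xᵢ₊₃ with i = v + 7.

Upper bound: modulo Q·Q and these n quartics every quartic monomial vanishes
(`CirculantSystem.mul_mem_all`). This is a rewriting argument: a product of two non-adjacent pairs
is zero, and pairs may be exchanged. Long distances are treated uniformly in n, the rest by a finite
computation. By duality, Q·Q in degree 4 is then the common kernel of the functionals, and this
yields degree 5 (`homogeneousSubmodule_five_le`).

Openness: Cramer's rule gives quadrics in Ann(f) depending polynomially on f, and spanning is
detected by a determinant (`exists_ne_zero_of_span`). `smallTangentSpace_of_span` turns these open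
conditions into Hilbert functions. -/

namespace Apolarity

/-! ### Combinatorics of the triples {i, i + 1, i + 3} modulo n -/

section Circulant

/-- `a` and `b` are distinct vertices of a common triple `{i, i + 1, i + 3}` of residues mod `n`. -/
def Adj (n : ℕ) (a b : ℤ) : Prop :=
  ∃ e ∈ [-3, -2, -1, 1, 2, (3 : ℤ)], (n : ℤ) ∣ b - a - e

/-- A sufficient condition for `¬ Adj n a b`, valid for every `n ≥ 18`. -/
def far (a b : ℤ) : Bool := a == b || (decide (4 ≤ (a - b).natAbs) && decide ((a - b).natAbs ≤ 14))

/-- The third vertex of the triple `{i, i + 1, i + 3}` through `a` and `b`. -/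
def third (a b : ℤ) : Option ℤ :=
  if b - a = 1 then some (a + 3) else if b - a = -1 then some (b + 3)
  else if b - a = 2 then some (a - 1) else if b - a = -2 then some (b - 1)
  else if b - a = 3 then some (a + 1) else if b - a = -3 then some (b + 1) else none

/-- The pairs which form a triple together with `p`. -/
def link (p : ℤ) : List (ℤ × ℤ) := [(p + 1, p + 3), (p - 1, p + 2), (p - 3, p - 2)]

/-- The splittings of a quadruple into two pairs. -/
def splits (a b c d : ℤ) : List ((ℤ × ℤ) × (ℤ × ℤ)) :=
  [((a, b), (c, d)), ((a, c), (b, d)), ((a, d), (b, c)),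
    ((c, d), (a, b)), ((b, d), (a, c)), ((b, c), (a, d))]

/-- `{a, b, c}` is a triple `{i, i + 1, i + 3}` with `i - v` in a range where `v` is not
adjacent to `i + 1`. -/
def remote (v a b c : ℤ) : Bool :=
  [(a, b, c), (a, c, b), (b, a, c), (b, c, a), (c, a, b), (c, b, a)].any fun t =>
    decide (t.2.1 = t.1 + 1) && decide (t.2.2 = t.1 + 3) &&
      ((decide (3 ≤ t.1 - v) && decide (t.1 - v ≤ 14)) ||
        (decide (-15 ≤ t.1 - v) && decide (t.1 - v ≤ -4)))

/-- Quadruples whose product vanishes for an immediate reason. -/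
def vanishesAtOnce (a b c d : ℤ) : Bool :=
  ((splits a b c d).any fun s => far s.1.1 s.1.2 && far s.2.1 s.2.2) ||
    remote a b c d || remote b a c d || remote c a b d || remote d a b c

/-- Quadruples whose product vanishes after at most `k` exchanges of a pair. -/
def vanishes : ℕ → ℤ → ℤ → ℤ → ℤ → Bool
  | 0, a, b, c, d => vanishesAtOnce a b c d
  | k + 1, a, b, c, d => vanishesAtOnce a b c d ||
      (splits a b c d).any fun s => far s.1.1 s.1.2 &&
        (third s.2.1 s.2.2).any fun p =>
          (link p).any fun l => vanishes k s.1.1 s.1.2 l.1 l.2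

/-- Quadruples whose product vanishes after at most one exchange of two pairs. -/
def vanishesDouble (k : ℕ) (a b c d : ℤ) : Bool :=
  vanishes k a b c d || (splits a b c d).any fun s =>
    (third s.1.1 s.1.2).any fun p => (third s.2.1 s.2.2).any fun q =>
      (link p).any fun l => (link q).any fun m =>
        vanishes k s.1.1 s.1.2 m.1 m.2 && vanishes k s.2.1 s.2.2 l.1 l.2 &&
          vanishes k l.1 l.2 m.1 m.2

/-- The tests `far` and `remote` use integer offsets and are sound for every n ≥ 18, so one finite
computation covers all n. -/
lemma vanishesDouble_star : ∀ b ∈ [-3, -2, -1, 1, 2, (3 : ℤ)], ∀ c ∈ [-3, -2, -1, 1, 2, (3 : ℤ)],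
    ∀ d ∈ [-3, -2, -1, 1, 2, (3 : ℤ)], vanishesDouble 2 0 b c d = true := by
  decide +kernel

lemma vanishesDouble_triangle : ∀ b ∈ [-3, -2, -1, 1, 2, (3 : ℤ)],
    ∀ c ∈ [-3, -2, -1, 1, 2, (3 : ℤ)], c - b ∈ [-3, -2, -1, 1, 2, (3 : ℤ)] →
    ∀ s ∈ (List.range 25).map (fun j : ℕ => (j : ℤ) - 12), vanishesDouble 1 0 b c s = true := by
  decide +kernel

/-- A triangle `{0, b, c}` which is a triple `{i, i + 1, i + 3}`, or whose product with any vertex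
far away vanishes after an exchange of `b`, `c`. -/
lemma triangle_far : ∀ b ∈ [-3, -2, -1, 1, 2, (3 : ℤ)],
    ∀ c ∈ [-3, -2, -1, 1, 2, (3 : ℤ)], c - b ∈ [-3, -2, -1, 1, 2, (3 : ℤ)] →
    ([((0 : ℤ), b, c), (0, c, b), (b, 0, c), (b, c, 0), (c, 0, b), (c, b, 0)].any fun t =>
      decide (t.2.1 = t.1 + 1) && decide (t.2.2 = t.1 + 3) &&
        (decide (-3 ≤ t.1) && decide (t.1 ≤ 0))) = true ∨
    ((third b c).any fun p => (link p).any fun l => (far 0 l.1 && decide (l.2.natAbs ≤ 8)) ||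
      (far 0 l.2 && decide (l.1.natAbs ≤ 8))) = true := by
  decide +kernel

variable {n : ℕ} {S : Type*} [CommRing S]

/-- Here |b - a - e| ≤ 14 + 3 = 17 < n, so divisibility by n would force b - a = e. The bound 14 in
`far` is 18 - 4. -/
lemma not_adj_of_far (hn : 18 ≤ n) {a b : ℤ} (h : far a b = true) (t : ℤ) :
    ¬ Adj n (t + a) (t + b) := by
  rintro ⟨e, he, hd⟩
  have h0 : t + b - (t + a) - e = 0 := by
    apply Int.eq_zero_of_abs_lt_dvd hd
    simp [far] at h
    simp at he
    rw [abs_lt]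
    omega
  simp [far] at h
  simp at he
  omega

lemma adj_symm {a b : ℤ} (h : Adj n a b) : Adj n b a := by
  obtain ⟨e, he, d, hd⟩ := h
  refine ⟨-e, ?_, -d, ?_⟩
  · simp at he ⊢; omega
  · linarith

/-- The products of the elements of `Q` lie in `W`, as do certain products of four variables, and
`Q` contains the quadrics annihilating the cubic `∑ xᵢ xᵢ₊₁ xᵢ₊₃`, indices modulo `n`. -/
structure CirculantSystem (n : ℕ) (x : ℤ → S) (Q : Set S) (W : AddSubgroup S) : Prop where
  le : 18 ≤ n
  periodic : ∀ a b, (n : ℤ) ∣ b - a → x b = x a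
  mul_mem : ∀ q ∈ Q, ∀ q' ∈ Q, q * q' ∈ W
  of_not_adj : ∀ a b, ¬ Adj n a b → x a * x b ∈ Q
  exchange : ∀ p, ∀ l ∈ link p, ∀ m ∈ link p, x l.1 * x l.2 - x m.1 * x m.2 ∈ Q
  base : ∀ v, x v * (x (v + 7) * x (v + 8) * x (v + 10)) ∈ W

/-! ### Rewriting quartic monomials modulo products of quadrics -/

namespace CirculantSystem

variable {x : ℤ → S} {Q : Set S} {W : AddSubgroup S}

lemma link_of_third {a b p : ℤ} (h : third a b = some p) (t : ℤ) :
    (t + a, t + b) ∈ link (t + p) ∨ (t + b, t + a) ∈ link (t + p) := by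
  unfold third at h
  split_ifs at h with h1 h2 h3 h4 h5 h6 <;> simp only [Option.some.injEq] at h <;> subst h <;>
    simp only [link, List.mem_cons, Prod.mk.injEq, List.not_mem_nil, or_false] <;> omega

lemma add_mem_link {p : ℤ} {l : ℤ × ℤ} (h : l ∈ link p) (t : ℤ) :
    (t + l.1, t + l.2) ∈ link (t + p) := by
  obtain ⟨l1, l2⟩ := l
  simp only [link, List.mem_cons, Prod.mk.injEq, List.not_mem_nil, or_false] at h ⊢
  omega

lemma mul_eq_of_mem_splits {a b c d : ℤ} {s : (ℤ × ℤ) × (ℤ × ℤ)} (h : s ∈ splits a b c d)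
    (y : ℤ → S) : y a * y b * (y c * y d) = y s.1.1 * y s.1.2 * (y s.2.1 * y s.2.2) := by
  simp only [splits, List.mem_cons, List.not_mem_nil, or_false] at h
  rcases h with rfl | rfl | rfl | rfl | rfl | rfl <;> ring

variable (H : CirculantSystem n x Q W)
include H

lemma mul_mem_of_not_adj {a b c d : ℤ} (h : ¬ Adj n a b) (h' : ¬ Adj n c d) :
    x a * x b * (x c * x d) ∈ W :=
  H.mul_mem _ (H.of_not_adj _ _ h) _ (H.of_not_adj _ _ h')

lemma exchange_third {a b p : ℤ} (h : third a b = some p) {l : ℤ × ℤ} (hl : l ∈ link p) (t : ℤ) :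
    x (t + a) * x (t + b) - x (t + l.1) * x (t + l.2) ∈ Q := by
  rcases link_of_third h t with h' | h'
  · exact H.exchange _ _ h' _ (add_mem_link hl t)
  · rw [mul_comm (x (t + a))]
    exact H.exchange _ _ h' _ (add_mem_link hl t)

/-- The triples starting at i and i + 1 share the vertex i + 1, which is not adjacent to v. So x_v
xᵢ₊₁ ∈ Q multiplies the exchange of their remaining pairs at i + 1. -/
lemma triple_step {v i : ℤ} (h1 : 3 ≤ i - v) (h2 : i - v ≤ n - 5) :
    x v * (x i * x (i + 1) * x (i + 3)) -
      x v * (x (i + 1) * x (i + 1 + 1) * x (i + 1 + 3)) ∈ W := by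
  have hA : ¬ Adj n v (i + 1) := by
    rintro ⟨e, he, hd⟩
    simp only [List.mem_cons, List.not_mem_nil, or_false] at he
    have := Int.eq_zero_of_abs_lt_dvd hd (by rw [abs_lt]; omega)
    omega
  have := H.mul_mem _ (H.of_not_adj _ _ hA) _ (H.exchange (i + 1) (i + 1 - 1, i + 1 + 2)
    (by simp [link]) (i + 1 + 1, i + 1 + 3) (by simp [link]))
  convert this using 1
  simp only [show i + 1 - 1 = i by ring, show i + 1 + 2 = i + 3 by ring]
  ring

/-- Steps of length one connect every such triple to the one at v + 7, which is in W by `base`. -/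
lemma triple_mem {v i : ℤ} (h1 : 3 ≤ i - v) (h2 : i - v ≤ n - 4) :
    x v * (x i * x (i + 1) * x (i + 3)) ∈ W := by
  have hn := H.le
  have h7 : ∀ i, i - v = 7 → x v * (x i * x (i + 1) * x (i + 3)) ∈ W := by
    intro i hi
    obtain rfl : i = v + 7 := by omega
    simpa only [add_assoc, Int.reduceAdd] using H.base v
  have up : ∀ j : ℕ, ∀ i, i - v = 7 + j → i - v ≤ n - 4 →
      x v * (x i * x (i + 1) * x (i + 3)) ∈ W := by
    intro j
    induction j with
    | zero => intro i hi _; exact h7 i (by simpa using hi)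
    | succ j ih =>
      intro i hi hi'
      have h := H.triple_step (v := v) (i := i - 1) (by omega) (by omega)
      have := W.sub_mem (ih (i - 1) (by push_cast at hi; omega) (by omega)) h
      simpa only [sub_sub_cancel, sub_add_cancel] using this
  have down : ∀ j : ℕ, j ≤ 4 → ∀ i, i - v = 7 - j → x v * (x i * x (i + 1) * x (i + 3)) ∈ W := by
    intro j
    induction j with
    | zero => intro _ i hi; exact h7 i (by simpa using hi)
    | succ j ih =>
      intro hj i hi
      have h := H.triple_step (v := v) (i := i) (by push_cast at hi; omega)
        (by push_cast at hi; omega)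
      have := W.add_mem h (ih (by omega) (i + 1) (by push_cast at hi; omega))
      simpa only [sub_add_cancel] using this
  by_cases h : 7 ≤ i - v
  · exact up (i - v - 7).toNat i (by omega) h2
  · exact down (7 - (i - v)).toNat (by omega) i (by omega)

lemma triple_mem' {v i : ℤ} (h : (3 ≤ i - v ∧ i - v ≤ 14) ∨ (-15 ≤ i - v ∧ i - v ≤ -4)) :
    x v * (x i * x (i + 1) * x (i + 3)) ∈ W := by
  have hn := H.le
  rcases h with h | h
  · exact H.triple_mem h.1 (by omega)
  -- Replacing v by v - n moves the range [-15, -4] to [n - 15, n - 4], which lies in [3, n - 4]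
  -- because n ≥ 18.
  · rw [H.periodic (v - n) v (by simp)]
    exact H.triple_mem (by omega) (by omega)

lemma remote_mem {v a b c : ℤ} (h : remote v a b c = true) (t : ℤ) :
    x (t + v) * (x (t + a) * x (t + b) * x (t + c)) ∈ W := by
  simp only [remote, List.any_eq_true, Bool.and_eq_true, Bool.or_eq_true, decide_eq_true_eq] at h
  obtain ⟨⟨i, j, k⟩, hm, ⟨hj, hk⟩, hr⟩ := h
  dsimp only at hj hk hr
  subst hj hk
  have := H.triple_mem' (v := t + v) (i := t + i) (by omega)
  simp only [add_assoc] at this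
  simp only [List.mem_cons, List.not_mem_nil, or_false, Prod.mk.injEq] at hm
  rcases hm with ⟨rfl, rfl, rfl⟩ | ⟨rfl, rfl, rfl⟩ | ⟨rfl, rfl, rfl⟩ | ⟨rfl, rfl, rfl⟩ |
    ⟨rfl, rfl, rfl⟩ | ⟨rfl, rfl, rfl⟩ <;> convert this using 1 <;> ring

lemma vanishesAtOnce_mem {a b c d : ℤ} (h : vanishesAtOnce a b c d = true) (t : ℤ) :
    x (t + a) * x (t + b) * (x (t + c) * x (t + d)) ∈ W := by
  simp only [vanishesAtOnce, Bool.or_eq_true, List.any_eq_true, Bool.and_eq_true] at h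
  rcases h with (((⟨s, hs, h1, h2⟩ | h) | h) | h) | h
  · rw [mul_eq_of_mem_splits hs fun a => x (t + a)]
    exact H.mul_mem_of_not_adj (not_adj_of_far H.le h1 t) (not_adj_of_far H.le h2 t)
  all_goals convert H.remote_mem h t using 1; ring

lemma vanishes_mem (k : ℕ) {a b c d : ℤ} (h : vanishes k a b c d = true) (t : ℤ) :
    x (t + a) * x (t + b) * (x (t + c) * x (t + d)) ∈ W := by
  induction k generalizing a b c d with
  | zero => exact H.vanishesAtOnce_mem h t
  | succ k ih =>
    simp only [vanishes, Bool.or_eq_true, List.any_eq_true, Bool.and_eq_true,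
      Option.any_eq_true] at h
    rcases h with h | ⟨s, hs, h1, p, hp, l, hl, h2⟩
    · exact H.vanishesAtOnce_mem h t
    · rw [mul_eq_of_mem_splits hs fun a => x (t + a)]
      -- The far pair lies in Q, so multiplying it by an exchange replaces the other pair modulo
      -- Q·Q.
      have := W.add_mem (H.mul_mem _ (H.of_not_adj _ _ (not_adj_of_far H.le h1 t)) _
        (H.exchange_third hp hl t)) (ih h2)
      convert this using 1
      ring

lemma vanishesDouble_mem (k : ℕ) {a b c d : ℤ} (h : vanishesDouble k a b c d = true) (t : ℤ) :
    x (t + a) * x (t + b) * (x (t + c) * x (t + d)) ∈ W := by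
  simp only [vanishesDouble, Bool.or_eq_true, List.any_eq_true, Bool.and_eq_true,
    Option.any_eq_true] at h
  rcases h with h | ⟨s, hs, p, hp, q, hq, l, hl, m, hm, ⟨h1, h2⟩, h3⟩
  · exact H.vanishes_mem k h t
  · rw [mul_eq_of_mem_splits hs fun a => x (t + a)]
    -- With pairs A, B exchanged for L, M, this is AB = (A - L)(B - M) + AM + BL - LM; neither A nor
    -- B need lie in Q.
    have := W.sub_mem (W.add_mem (W.add_mem (H.mul_mem _ (H.exchange_third hp hl t) _
      (H.exchange_third hq hm t)) (H.vanishes_mem k h1 t)) (H.vanishes_mem k h2 t))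
      (H.vanishes_mem k h3 t)
    convert this using 1
    ring

omit H in
lemma not_adj_of_le_sub {n : ℕ} {a b : ℤ} (h1 : 4 ≤ b - a) (h2 : b - a ≤ n - 4) : ¬ Adj n a b := by
  rintro ⟨e, he, hd⟩
  simp only [List.mem_cons, List.not_mem_nil, or_false] at he
  have := Int.eq_zero_of_abs_lt_dvd hd (by rw [abs_lt]; omega)
  omega

/-- A triangle together with a vertex far away from it. -/
lemma triangle_far_mem {b c d : ℤ} (hb : b ∈ [-3, -2, -1, 1, 2, (3 : ℤ)])
    (hc : c ∈ [-3, -2, -1, 1, 2, (3 : ℤ)]) (hbc : c - b ∈ [-3, -2, -1, 1, 2, (3 : ℤ)])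
    (h1 : 12 ≤ d) (h2 : d ≤ n - 12) (t : ℤ) :
    x t * x (t + b) * (x (t + c) * x (t + d)) ∈ W := by
  rcases triangle_far b hb c hc hbc with h | h
  · simp only [List.any_eq_true, Bool.and_eq_true, decide_eq_true_eq] at h
    obtain ⟨⟨i, j, k⟩, hm, ⟨hj, hk⟩, hr⟩ := h
    dsimp only at hj hk hr
    subst hj hk
    -- With d lowered by n, the offset of the triple from the far vertex lies between 9 and n - 12.
    have := H.triple_mem (v := t + d - n) (i := t + i) (by omega) (by omega)
    rw [← H.periodic (t + d - n) (t + d) (by simp)] at this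
    simp only [add_assoc] at this
    simp only [List.mem_cons, List.not_mem_nil, or_false, Prod.mk.injEq] at hm
    have ht : x t = x (t + 0) := by rw [add_zero]
    rw [ht]
    rcases hm with ⟨h0, rfl, rfl⟩ | ⟨h0, rfl, rfl⟩ | ⟨rfl, h0, rfl⟩ | ⟨rfl, rfl, h0⟩ |
      ⟨rfl, h0, rfl⟩ | ⟨rfl, rfl, h0⟩ <;> rw [← h0] <;> 
        convert this using 1 <;> ring
  · simp only [List.any_eq_true, Bool.and_eq_true, Bool.or_eq_true, Option.any_eq_true,
      decide_eq_true_eq] at h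
    obtain ⟨p, hp, l, hl, h⟩ := h
    have hadj : ∀ m : ℤ, m.natAbs ≤ 8 → ¬ Adj n (t + m) (t + d) := fun m hm =>
      not_adj_of_le_sub (by omega) (by omega)
    have hnear : ¬ Adj n t (t + d) := not_adj_of_le_sub (by omega) (by omega)
    have h' := H.mul_mem _ (H.of_not_adj _ _ hnear) _ (H.exchange_third hp hl t)
    -- After the exchange the four vertices split into two non-adjacent pairs: one vertex of l is
    -- far from t, the other is near t and hence far from t + d.
    have h0 : x t * x (t + d) * (x (t + l.1) * x (t + l.2)) ∈ W := by
      rcases h with ⟨h, hm⟩ | ⟨h, hm⟩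
      · have := H.mul_mem_of_not_adj (not_adj_of_far H.le h t) (hadj _ hm)
        rw [add_zero] at this
        convert this using 1; ring
      · have := H.mul_mem_of_not_adj (not_adj_of_far H.le h t) (hadj _ hm)
        rw [add_zero] at this
        convert this using 1; ring
    convert W.add_mem h' h0 using 1
    ring

lemma mul_mem_of_triangle {a b c d : ℤ} (hab : Adj n a b) (hac : Adj n a c) (hbc : Adj n b c) :
    x a * x b * (x c * x d) ∈ W := by
  have hn := H.le
  obtain ⟨e, he, h1⟩ := hab
  obtain ⟨f, hf, h2⟩ := hac
  obtain ⟨g, hg, h3⟩ := hbc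
  -- The congruence is an equality of integers, since |f - e - g| ≤ 9 < n. The triangle is thus one
  -- of finitely many integer configurations.
  have hg' : f - e = g := by
    have h4 : (n : ℤ) ∣ f - e - g := by
      have := (h3.sub h2).add h1
      rwa [show c - b - g - (c - a - f) + (b - a - e) = f - e - g by ring] at this
    have := Int.eq_zero_of_abs_lt_dvd h4 (by
      simp only [List.mem_cons, List.not_mem_nil, or_false] at he hf hg
      rw [abs_lt]; omega)
    omega
  have hs0 := Int.emod_nonneg (d - a) (show (n : ℤ) ≠ 0 by omega)
  have hs1 := Int.emod_lt_of_pos (d - a) (show (0 : ℤ) < n by omega)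
  have hs2 : (n : ℤ) ∣ d - (a + (d - a) % n) := by
    have := Int.dvd_sub_self_of_emod_eq (a := d - a) (b := n) rfl
    rwa [← sub_sub, dvd_sub_comm]
  generalize (d - a) % n = s at hs0 hs1 hs2
  rw [H.periodic (a + e) b (by rwa [← sub_sub]), H.periodic (a + f) c (by rwa [← sub_sub])]
  subst hg'
  -- Fourth vertices within distance 12 of a are covered by the computation, all others by
  -- `triangle_far_mem`.
  have near : ∀ s, -12 ≤ s → s ≤ 12 → (n : ℤ) ∣ d - (a + s) →
      x a * x (a + e) * (x (a + f) * x d) ∈ W := by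
    intro s h1 h2 h3
    rw [H.periodic (a + s) d h3]
    have := H.vanishesDouble_mem 1 (vanishesDouble_triangle e he f hf hg s
      (List.mem_map.2 ⟨(s + 12).toNat, by simp; omega, by simp; omega⟩)) a
    rwa [add_zero] at this
  by_cases h12 : s ≤ 12
  · exact near s (by omega) h12 hs2
  by_cases h12' : n - 12 ≤ s
  · exact near (s - n) (by omega) (by omega) (by
      rw [show d - (a + (s - n)) = d - (a + s) + n by ring]; exact hs2.add (dvd_refl _))
  rw [H.periodic (a + s) d hs2]
  exact H.triangle_far_mem he hf hg (by omega) (by omega) a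

lemma mul_mem_of_star {a b c d : ℤ} (hb : Adj n a b) (hc : Adj n a c) (hd : Adj n a d) :
    x a * x b * (x c * x d) ∈ W := by
  obtain ⟨e, he, h1⟩ := hb
  obtain ⟨f, hf, h2⟩ := hc
  obtain ⟨g, hg, h3⟩ := hd
  rw [H.periodic (a + e) b (by rwa [← sub_sub]), H.periodic (a + f) c (by rwa [← sub_sub]),
    H.periodic (a + g) d (by rwa [← sub_sub])]
  have := H.vanishesDouble_mem 2 (vanishesDouble_star e he f hf g hg) a
  rwa [add_zero] at this

/-- In a circulant system, all products of four variables lie in `W`. -/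
theorem mul_mem_all (a b c d : ℤ) : x a * x b * (x c * x d) ∈ W := by
  have s1 : x a * x b * (x c * x d) = x a * x c * (x b * x d) := by ring
  have s2 : x a * x b * (x c * x d) = x a * x d * (x b * x c) := by ring
  by_cases h1 : ¬ Adj n a b ∧ ¬ Adj n c d
  · exact H.mul_mem_of_not_adj h1.1 h1.2
  by_cases h2 : ¬ Adj n a c ∧ ¬ Adj n b d
  · rw [s1]; exact H.mul_mem_of_not_adj h2.1 h2.2
  by_cases h3 : ¬ Adj n a d ∧ ¬ Adj n b c
  · rw [s2]; exact H.mul_mem_of_not_adj h3.1 h3.2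
  rw [not_and_or, not_not, not_not] at h1 h2 h3
  -- Each of the three perfect matchings of the four vertices now contains an adjacent pair. One
  -- edge from each matching of K₄ gives a star or a triangle: four of each.
  rcases h1 with h1 | h1 <;> rcases h2 with h2 | h2 <;> rcases h3 with h3 | h3
  · exact H.mul_mem_of_star h1 h2 h3
  · exact H.mul_mem_of_triangle h1 h2 h3
  · convert H.mul_mem_of_triangle h1 h3 h2 (d := c) using 1; ring
  · convert H.mul_mem_of_star (adj_symm h1) h3 h2 using 1; ring
  · convert H.mul_mem_of_triangle h2 h3 h1 (d := b) using 1; ring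
  · convert H.mul_mem_of_star h1 (adj_symm h2) (adj_symm h3) using 1; ring
  · convert H.mul_mem_of_star (adj_symm h1) (adj_symm h2) (adj_symm h3) using 1; ring
  · convert H.mul_mem_of_triangle h3 h2 h1 (d := a) using 1; ring

end CirculantSystem
end Circulant

open MvPolynomial

/-! ### Computing Hilbert functions by dual functionals -/

section HilbertFunction

variable {n : ℕ} {k : Type u} [Field k]

/-- A criterion for the value of the Hilbert function of `S/J`: forms generating the degree `i`
part modulo `J`, which are told apart by functionals vanishing on `J`. -/
lemma hilbert_eq_card (J : Ideal (S n k)) (i : ℕ) {ι : Type*} [Fintype ι] [DecidableEq ι]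
    (w : ι → S n k) (hw : ∀ v, w v ∈ homogeneousSubmodule (Fin n) k i)
    (hspan : homogeneousSubmodule (Fin n) k i ≤
      J.restrictScalars k ⊔ Submodule.span k (Set.range w))
    (L : ι → S n k →ₗ[k] k) (hL : ∀ u, ∀ s ∈ J, L u s = 0)
    (hdet : (Matrix.of fun u v => L u (w v)).det ≠ 0) :
    hilbert J i = Fintype.card ι := by
  have hmap : (homogeneousSubmodule (Fin n) k i).map (Ideal.Quotient.mkₐ k J).toLinearMap =
      Submodule.span k (Set.range fun v => Ideal.Quotient.mkₐ k J (w v)) := by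
    apply le_antisymm
    · refine (Submodule.map_mono hspan).trans ?_
      rw [Submodule.map_sup, Submodule.map_span, ← Set.range_comp]
      refine sup_le ?_ le_rfl
      rintro _ ⟨s, hs, rfl⟩
      have : (Ideal.Quotient.mkₐ k J).toLinearMap s = 0 := Ideal.Quotient.eq_zero_iff_mem.2 hs
      rw [this]
      exact zero_mem _
    · rw [Submodule.span_le]
      rintro _ ⟨v, rfl⟩
      exact ⟨w v, hw v, rfl⟩
  have hind : LinearIndependent k fun v => Ideal.Quotient.mkₐ k J (w v) := by
    rw [Fintype.linearIndependent_iff]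
    intro c hc
    have hmem : ∑ v, c v • w v ∈ J := by
      rw [← Ideal.Quotient.eq_zero_iff_mem, ← Ideal.Quotient.mkₐ_eq_mk k]
      simpa only [map_sum, map_smul] using hc
    have h0 : Matrix.mulVec (Matrix.of fun u v => L u (w v)) c = 0 := by
      funext u
      have := hL u _ hmem
      simp only [map_sum, map_smul, smul_eq_mul] at this
      simpa [Matrix.mulVec, dotProduct, mul_comm] using this
    exact fun v => congrFun (Matrix.eq_zero_of_mulVec_eq_zero hdet h0) v
  rw [hilbert, hmap]
  exact finrank_span_eq_card hind

end HilbertFunction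

/-! ### Apolar ideals of homogeneous functionals -/

section Cubics

variable {n : ℕ} {k : Type u} [Field k]

lemma mem_Ann_iff {f : P n k} {s : S n k} : s ∈ Ann f ↔ ∀ t, f.1 (s * t) = 0 := by
  constructor
  · intro h t
    exact LinearMap.congr_fun (congrArg Subtype.val (show contract s f = 0 from h)) t
  · intro h
    exact Subtype.ext (LinearMap.ext fun t => h t)

lemma IsHomogeneousOfDegree.apply_monomial {f : P n k} {d : ℕ} (hf : IsHomogeneousOfDegree f d)
    {a : Fin n →₀ ℕ} (ha : a.degree ≠ d) (c : k) : f.1 (monomial a c) = 0 := by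
  induction hf using Submodule.span_induction with
  | mem g hg =>
    obtain ⟨b, hb, rfl⟩ := hg
    change coeff b (monomial a c) = 0
    rw [coeff_monomial, if_neg]
    rintro rfl
    exact ha hb
  | zero => rfl
  | add g h _ _ hg hh =>
    change g.1 _ + h.1 _ = 0
    rw [hg, hh, add_zero]
  | smul r g _ hg =>
    change r • g.1 _ = 0
    rw [hg, smul_zero]

lemma IsHomogeneousOfDegree.apply_eq_zero {f : P n k} {d e : ℕ} (hf : IsHomogeneousOfDegree f d)
    {s : S n k} (hs : s ∈ homogeneousSubmodule (Fin n) k e) (hde : e ≠ d) : f.1 s = 0 := by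
  rw [s.as_sum, map_sum]
  refine Finset.sum_eq_zero fun a ha => hf.apply_monomial ?_ _
  rintro rfl
  apply hde
  have := (mem_homogeneousSubmodule _ _).1 hs (mem_support_iff.1 ha)
  rw [← this, Finsupp.degree_eq_weight_one]
  rfl

/-- Products of total degree other than d are killed by f anyway, so only multipliers of the
complementary degree need testing. -/
lemma IsHomogeneousOfDegree.mem_Ann {f : P n k} {d e e' : ℕ} (hf : IsHomogeneousOfDegree f d)
    {s : S n k} (hs : s ∈ homogeneousSubmodule (Fin n) k e) (he : e + e' = d)
    (h : ∀ a : Fin n →₀ ℕ, a.degree = e' → f.1 (s * monomial a 1) = 0) : s ∈ Ann f := by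
  rw [mem_Ann_iff]
  intro t
  induction t using MvPolynomial.induction_on' with
  | monomial a c =>
    have hc : f.1 (s * monomial a c) = c • f.1 (s * monomial a 1) := by
      rw [← map_smul, ← mul_smul_comm, smul_monomial, smul_eq_mul, mul_one]
    rw [hc]
    by_cases ha : a.degree = e'
    · rw [h a ha, smul_zero]
    · rw [hf.apply_eq_zero (e := e + a.degree), smul_zero]
      · exact IsHomogeneous.mul hs (isHomogeneous_monomial _ rfl)
      · omega
  | add p q hp hq => rw [mul_add, map_add, hp, hq, add_zero]

lemma IsHomogeneousOfDegree.mem_Ann_of_lt {f : P n k} {d e : ℕ} (hf : IsHomogeneousOfDegree f d)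
    {s : S n k} (hs : s ∈ homogeneousSubmodule (Fin n) k e) (he : d < e) : s ∈ Ann f := by
  rw [mem_Ann_iff]
  intro t
  induction t using MvPolynomial.induction_on' with
  | monomial a c =>
    exact hf.apply_eq_zero (IsHomogeneous.mul hs (isHomogeneous_monomial _ rfl)) (by omega)
  | add p q hp hq => rw [mul_add, map_add, hp, hq, add_zero]

lemma IsHomogeneousOfDegree.mem_Ann_of_quadric {f : P n k} (hf : IsHomogeneousOfDegree f 3)
    {s : S n k} (hs : s ∈ homogeneousSubmodule (Fin n) k 2) (h : ∀ t, f.1 (X t * s) = 0) :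
    s ∈ Ann f := by
  refine hf.mem_Ann hs (e' := 1) rfl fun a ha => ?_
  obtain ⟨t, rfl⟩ : a ∈ Set.range fun t : Fin n => Finsupp.single t 1 := by
    rw [Finsupp.range_single_one]; exact ha
  rw [mul_comm]
  exact h t

/-- The functional `x_u f`, of degree one more than `f`, vanishes on the square of `Ann(f)`. -/
lemma apply_pderiv_eq_zero (f : P n k) (u : Fin n) {s : S n k} (hs : s ∈ Ann f ^ 2) :
    f.1 (pderiv u s) = 0 := by
  rw [pow_two] at hs
  induction hs using Submodule.mul_induction_on' with
  | mem_mul_mem p hp q hq =>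
    rw [Derivation.leibniz, map_add, smul_eq_mul, smul_eq_mul, mem_Ann_iff.1 hp,
      mem_Ann_iff.1 hq, add_zero]
  | add p _ q _ hp hq => rw [map_add, map_add, hp, hq, add_zero]

end Cubics

/-! ### Annihilating quadrics in families, and openness of spanning -/

section Generic

variable {n : ℕ} {A : Type*} [CommRing A]

/-- The matrix of values of a functional on the products of variables and given quadrics. -/
noncomputable def pairingMatrix (E : Fin n → MvPolynomial (Fin n) A)
    (l : MvPolynomial (Fin n) A →ₗ[A] A) :
    Matrix (Fin n) (Fin n) A :=
  Matrix.of fun s r => l (X s * E r)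

/-- The quadric obtained from `q` by Cramer's rule which is orthogonal to all variables. -/
noncomputable def cramerQuadric (E : Fin n → MvPolynomial (Fin n) A)
    (l : MvPolynomial (Fin n) A →ₗ[A] A) (q : MvPolynomial (Fin n) A) : MvPolynomial (Fin n) A :=
  (pairingMatrix E l).det • q -
    ∑ r, ((pairingMatrix E l).adjugate.mulVec fun s => l (X s * q)) r • E r

lemma apply_X_mul_cramerQuadric (E : Fin n → MvPolynomial (Fin n) A)
    (l : MvPolynomial (Fin n) A →ₗ[A] A) (q : MvPolynomial (Fin n) A) (t : Fin n) :
    l (X t * cramerQuadric E l q) = 0 := by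
  set v := (pairingMatrix E l).adjugate.mulVec fun s => l (X s * q) with hv
  have h : (pairingMatrix E l).mulVec v t = (pairingMatrix E l).det * l (X t * q) := by
    rw [hv, Matrix.mulVec_mulVec, Matrix.mul_adjugate, Matrix.smul_mulVec, Matrix.one_mulVec]
    rfl
  have h' : (pairingMatrix E l).mulVec v t = ∑ r, l (X t * E r) * v r := rfl
  rw [cramerQuadric, mul_sub, map_sub, mul_smul_comm, map_smul, smul_eq_mul, ← h, h',
    Finset.mul_sum, map_sum, sub_eq_zero]
  refine Finset.sum_congr rfl fun r _ => ?_
  rw [mul_smul_comm, map_smul, smul_eq_mul, mul_comm]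

variable {B : Type*} [CommRing B]

lemma pairingMatrix_map (φ : A →+* B) {E : Fin n → MvPolynomial (Fin n) A}
    {E' : Fin n → MvPolynomial (Fin n) B} (hE : ∀ r, map φ (E r) = E' r)
    {l : MvPolynomial (Fin n) A →ₗ[A] A} {l' : MvPolynomial (Fin n) B →ₗ[B] B}
    (hl : ∀ p, φ (l p) = l' (map φ p)) :
    φ.mapMatrix (pairingMatrix E l) = pairingMatrix E' l' := by
  ext s r
  simp [pairingMatrix, hl, hE]

/-- The adjugate replaces the inverse, so no division occurs and the construction commutes with
specialisation. -/
lemma cramerQuadric_map (φ : A →+* B) {E : Fin n → MvPolynomial (Fin n) A}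
    {E' : Fin n → MvPolynomial (Fin n) B} (hE : ∀ r, map φ (E r) = E' r)
    {l : MvPolynomial (Fin n) A →ₗ[A] A} {l' : MvPolynomial (Fin n) B →ₗ[B] B}
    (hl : ∀ p, φ (l p) = l' (map φ p)) (q : MvPolynomial (Fin n) A) :
    map φ (cramerQuadric E l q) = cramerQuadric E' l' (map φ q) := by
  have h := pairingMatrix_map φ hE hl
  simp only [cramerQuadric, ← h, map_sub, map_sum, smul_eq_C_mul, map_mul, map_C, hE,
    ← RingHom.map_det, ← RingHom.map_adjugate]
  congr 1
  refine Finset.sum_congr rfl fun r _ => ?_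
  congr 2
  simp [Matrix.mulVec, dotProduct, hl]

lemma cramerQuadric_isHomogeneous {E : Fin n → MvPolynomial (Fin n) A}
    (hE : ∀ r, (E r).IsHomogeneous 2) (l : MvPolynomial (Fin n) A →ₗ[A] A)
    {q : MvPolynomial (Fin n) A} (hq : q.IsHomogeneous 2) :
    (cramerQuadric E l q).IsHomogeneous 2 := by
  simp only [← mem_homogeneousSubmodule] at *
  exact sub_mem (Submodule.smul_mem _ _ hq) (sum_mem fun r _ => Submodule.smul_mem _ _ (hE r))

lemma degree_eq_of_mem_support {σ : Type*} {R : Type*} [CommSemiring R] {p : MvPolynomial σ R}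
    {d : ℕ} (hp : p.IsHomogeneous d) {a : σ →₀ ℕ} (ha : coeff a p ≠ 0) : a.degree = d := by
  rw [← hp ha, Finsupp.degree_eq_weight_one]
  rfl

lemma _root_.MvPolynomial.IsHomogeneous.eq_sum_monomial {σ R : Type*} [CommSemiring R] {d : ℕ}
    [Fintype {a : σ →₀ ℕ // a.degree = d}] {p : MvPolynomial σ R} (hp : p.IsHomogeneous d) :
    p = ∑ b : {a : σ →₀ ℕ // a.degree = d}, coeff b.1 p • monomial b.1 (1 : R) := by
  classical
  ext c
  simp only [coeff_sum, coeff_smul, coeff_monomial, smul_eq_mul, mul_ite, mul_one, mul_zero]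
  by_cases hc : coeff c p = 0
  · rw [hc, eq_comm]
    refine Finset.sum_eq_zero fun b _ => ?_
    split_ifs with h
    · rw [h, hc]
    · rfl
  · rw [Finset.sum_eq_single ⟨c, degree_eq_of_mem_support hp hc⟩]
    · simp
    · intro b _ hb
      rw [if_neg fun h => hb (Subtype.ext h)]
    · simp

/-- Spanning the forms of degree `d` is an open condition on a family of forms. -/
lemma exists_ne_zero_of_span {σ ι : Type*} [Finite σ] {k : Type*} [Field k] [Algebra k A]
    (φ : A →ₐ[k] k) (d : ℕ) (w : ι → MvPolynomial σ A) (hw : ∀ i, (w i).IsHomogeneous d)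
    (hspan : homogeneousSubmodule σ k d ≤
      Submodule.span k (Set.range fun i => map (φ : A →+* k) (w i))) :
    ∃ D : A, φ D ≠ 0 ∧ ∀ (K : Type u) [Field K] (ψ : A →+* K), ψ D ≠ 0 →
      homogeneousSubmodule σ K d ≤ Submodule.span K (Set.range fun i => map ψ (w i)) := by
  classical
  let T := {a : σ →₀ ℕ // a.degree = d}
  have hT : Finite T := Finsupp.finite_of_degree_eq d
  have := Fintype.ofFinite T
  have hc : ∀ a : T, ∃ c : ι →₀ k, monomial a.1 (1 : k) =
      c.sum fun i r => r • map (φ : A →+* k) (w i) := by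
    intro a
    have := hspan ((mem_homogeneousSubmodule _ _).2 (isHomogeneous_monomial (1 : k) a.2))
    obtain ⟨c, hc⟩ := Finsupp.mem_span_range_iff_exists_finsupp.1 this
    exact ⟨c, hc.symm⟩
  choose c hc using hc
  -- Lift the combinations expressing the monomials at the given point, with constant coefficients.
  -- Their coefficient matrix specialises to the identity there, and its determinant is the required
  -- D.
  let z : T → MvPolynomial σ A := fun a => (c a).sum fun i r => C (algebraMap k A r) * w i
  let M : Matrix T T A := Matrix.of fun a b => coeff b.1 (z a)
  have hz : ∀ a, (z a).IsHomogeneous d := fun a => by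
    rw [← mem_homogeneousSubmodule]
    refine sum_mem fun i _ => ?_
    change C _ * w i ∈ _
    rw [← smul_eq_C_mul]
    exact Submodule.smul_mem _ _ (hw i)
  have hzmap : ∀ a, map (φ : A →+* k) (z a) = monomial a.1 1 := by
    intro a
    rw [hc]
    simp [z, Finsupp.sum, smul_eq_C_mul]
  have hM : (φ : A →+* k).mapMatrix M = 1 := by
    ext a b
    have := congrArg (coeff b.1) (hzmap a)
    rw [coeff_map, coeff_monomial] at this
    simpa [M, Matrix.one_apply, ← Subtype.ext_iff] using this
  refine ⟨M.det, ?_, ?_⟩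
  · have : (φ : A →+* k) M.det = 1 := by rw [RingHom.map_det, hM, Matrix.det_one]
    rw [show φ M.det = 1 from this]
    exact one_ne_zero
  · intro K _ ψ hD p hp
    have hzexp : ∀ a, map ψ (z a) = ∑ b : T, ψ.mapMatrix M a b • monomial b.1 (1 : K) := fun a =>
      ((hz a).map ψ).eq_sum_monomial.trans <| Finset.sum_congr rfl fun b _ => by
        rw [coeff_map]; rfl
    have hzspan : ∀ a, map ψ (z a) ∈ Submodule.span K (Set.range fun i => map ψ (w i)) := by
      intro a
      have : map ψ (z a) = (c a).sum fun i r => ψ (algebraMap k A r) • map ψ (w i) := by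
        simp [z, Finsupp.sum, smul_eq_C_mul]
      rw [this]
      exact sum_mem fun i _ => Submodule.smul_mem _ _ (Submodule.subset_span ⟨i, rfl⟩)
    have hmon : ∀ b : T, monomial b.1 (1 : K) ∈
        Submodule.span K (Set.range fun i => map ψ (w i)) := by
      intro b
      have hdet : IsUnit (ψ.mapMatrix M).det := by
        rw [← RingHom.map_det]; exact isUnit_iff_ne_zero.2 hD
      have : monomial b.1 (1 : K) = ∑ a, (ψ.mapMatrix M)⁻¹ b a • map ψ (z a) := by
        simp only [hzexp, Finset.smul_sum, smul_smul]
        rw [Finset.sum_comm]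
        simp only [← Finset.sum_smul, ← Matrix.mul_apply, Matrix.nonsing_inv_mul _ hdet]
        rw [Finset.sum_eq_single b]
        · rw [Matrix.one_apply_eq, one_smul]
        · intro a _ hab
          rw [Matrix.one_apply_ne hab.symm, zero_smul]
        · simp
      rw [this]
      exact sum_mem fun a _ => Submodule.smul_mem _ _ (hzspan a)
    rw [p.as_sum]
    refine sum_mem fun a ha => ?_
    have hd : a.degree = d := degree_eq_of_mem_support hp (mem_support_iff.1 ha)
    have := Submodule.smul_mem _ (coeff a p) (hmon ⟨a, hd⟩)
    rwa [smul_monomial, smul_eq_mul, mul_one] at this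

end Generic

/-! ### Open conditions implying the small tangent space condition -/

section Criterion

variable {n : ℕ} {k : Type u} [Field k]

lemma exists_prod_X_eq_monomial {σ R : Type*} [CommSemiring R] (d : ℕ) (a : σ →₀ ℕ)
    (ha : a.degree = d) : ∃ v : Fin d → σ, monomial a (1 : R) = ∏ i, X (v i) := by
  induction d generalizing a with
  | zero =>
    obtain rfl := (Finsupp.degree_eq_zero_iff a).1 ha
    exact ⟨Fin.elim0, by simp⟩
  | succ d ih =>
    have hne : a ≠ 0 := by
      rintro rfl
      simp at ha
    obtain ⟨i, hi⟩ := Finsupp.ne_iff.1 hne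
    have hle : Finsupp.single i 1 ≤ a := by
      rw [Finsupp.single_le_iff]
      exact Nat.one_le_iff_ne_zero.2 hi
    have hdeg : (a - Finsupp.single i 1).degree = d := by
      have := congrArg Finsupp.degree (add_tsub_cancel_of_le hle)
      rw [map_add, Finsupp.degree_single] at this
      omega
    obtain ⟨v, hv⟩ := ih _ hdeg
    refine ⟨Fin.cons i v, ?_⟩
    rw [Fin.prod_univ_succ]
    simp only [Fin.cons_zero, Fin.cons_succ]
    rw [← hv, X, monomial_mul, one_mul, add_tsub_cancel_of_le hle]

lemma homogeneousSubmodule_le_of_prod_mem {σ : Type*} (d : ℕ) (W : Submodule k (MvPolynomial σ k))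
    (h : ∀ v : Fin d → σ, ∏ i, X (v i) ∈ W) : homogeneousSubmodule σ k d ≤ W := by
  intro p hp
  rw [p.as_sum]
  refine sum_mem fun a ha => ?_
  obtain ⟨v, hv⟩ := exists_prod_X_eq_monomial (R := k) d a
    (degree_eq_of_mem_support hp (mem_support_iff.1 ha))
  have := W.smul_mem (coeff a p) (h v)
  rwa [← hv, smul_monomial, smul_eq_mul, mul_one] at this

/-- Open conditions on a cubic `f` which imply the small tangent space condition. -/
theorem smallTangentSpace_of_span [NeZero n] {f : P n k} (hf : IsHomogeneousOfDegree f 3)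
    {E w : Fin n → S n k} (hE : ∀ r, (E r).IsHomogeneous 2) (hw : ∀ v, (w v).IsHomogeneous 4)
    (hdet : (pairingMatrix E f.1).det ≠ 0)
    (h4 : homogeneousSubmodule (Fin n) k 4 ≤
      Submodule.span k (Set.range fun p : (Fin n × Fin n) × (Fin n × Fin n) =>
        cramerQuadric E f.1 (X p.1.1 * X p.1.2) * cramerQuadric E f.1 (X p.2.1 * X p.2.2)) ⊔
      Submodule.span k (Set.range w))
    (hdet' : (Matrix.of fun u v => f.1 (pderiv u (w v))).det ≠ 0)
    (h5 : homogeneousSubmodule (Fin n) k 5 ≤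
      Submodule.span k (Set.range fun p : Fin n × (Fin n × Fin n) × (Fin n × Fin n) =>
        X p.1 * (cramerQuadric E f.1 (X p.2.1.1 * X p.2.1.2) *
          cramerQuadric E f.1 (X p.2.2.1 * X p.2.2.2)))) :
    SmallTangentSpace f := by
  have hXX : ∀ a b : Fin n, (X a * X b : S n k).IsHomogeneous 2 := fun a b =>
    (isHomogeneous_X k a).mul (isHomogeneous_X k b)
  have hU : ∀ a b, cramerQuadric E f.1 (X a * X b) ∈ Ann f := fun a b =>
    hf.mem_Ann_of_quadric (cramerQuadric_isHomogeneous hE _ (hXX a b))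
      (apply_X_mul_cramerQuadric E f.1 _)
  have hUU : ∀ a b c d, cramerQuadric E f.1 (X a * X b) * cramerQuadric E f.1 (X c * X d) ∈
      Ann f ^ 2 := fun a b c d => by
    rw [pow_two]
    exact Ideal.mul_mem_mul (hU a b) (hU c d)
  -- If f vanished on all cubic forms, the pairing matrix would be zero, and of nonzero size since n
  -- ≠ 0.
  obtain ⟨t, ht, hft⟩ : ∃ t ∈ homogeneousSubmodule (Fin n) k 3, f.1 t ≠ 0 := by
    by_contra! h
    apply hdet
    have hM : pairingMatrix E f.1 = 0 := by
      ext s r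
      exact h _ ((isHomogeneous_X k s).mul (hE r))
    have : Nonempty (Fin n) := ⟨0⟩
    rw [hM, Matrix.det_zero]
  constructor
  · rw [hilbert_eq_card (Ann f) 0 (fun _ : Fin 1 => (1 : S n k)) (fun _ => isHomogeneous_one _ _)
      ?_ (fun _ => f.1 ∘ₗ LinearMap.mulRight k t) ?_ (by simpa using hft)]
    · rfl
    · refine homogeneousSubmodule_le_of_prod_mem _ _ fun v => Submodule.mem_sup_right ?_
      exact Submodule.subset_span ⟨0, by simp⟩
    · exact fun _ s hs => mem_Ann_iff.1 hs t
  · rw [hilbert_eq_card (Ann f) 1 (fun v : Fin n => (X v : S n k)) (fun v => isHomogeneous_X _ v)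
      ?_ (fun u => f.1 ∘ₗ LinearMap.mulRight k (E u)) ?_ ?_]
    · exact Fintype.card_fin n
    · refine homogeneousSubmodule_le_of_prod_mem _ _ fun v => Submodule.mem_sup_right ?_
      exact Submodule.subset_span ⟨v 0, by simp⟩
    · exact fun u s hs => mem_Ann_iff.1 hs (E u)
    · rw [← Matrix.det_transpose]
      exact hdet
  · rw [hilbert_eq_card (Ann f) 2 E (fun v => hE v)
      ?_ (fun u => f.1 ∘ₗ LinearMap.mulRight k (X u)) ?_ ?_]
    · exact Fintype.card_fin n
    · refine homogeneousSubmodule_le_of_prod_mem _ _ fun v => ?_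
      rw [Fin.prod_univ_two]
      have h1 := hU (v 0) (v 1)
      -- The Cramer quadric shows that det · x_a x_b is, modulo Ann(f), a combination of the E r;
      -- the nonzero determinant is then cancelled.
      have h2 : (pairingMatrix E f.1).det • (X (v 0) * X (v 1)) ∈
          (Ann f).restrictScalars k ⊔ Submodule.span k (Set.range E) := by
        rw [← sub_add_cancel ((pairingMatrix E f.1).det • (X (v 0) * X (v 1) : S n k))
          (∑ r, ((pairingMatrix E f.1).adjugate.mulVec fun s => f.1 (X s * (X (v 0) * X (v 1)))) r
            • E r)]
        refine add_mem (Submodule.mem_sup_left h1) (Submodule.mem_sup_right ?_)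
        exact sum_mem fun r _ => Submodule.smul_mem _ _ (Submodule.subset_span ⟨r, rfl⟩)
      exact (Submodule.smul_mem_iff _ hdet).1 h2
    · exact fun u s hs => mem_Ann_iff.1 hs (X u)
    · convert hdet using 2
      ext u v
      simp [pairingMatrix, mul_comm]
  · rw [hilbert_eq_card (Ann f) 3 (fun _ : Fin 1 => t) (fun _ => ht)
      ?_ (fun _ => f.1) ?_ (by simpa using hft)]
    · rfl
    · intro s hs
      rw [← sub_add_cancel s ((f.1 s * (f.1 t)⁻¹) • t)]
      refine add_mem (Submodule.mem_sup_left ?_) (Submodule.mem_sup_right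
        (Submodule.smul_mem _ _ (Submodule.subset_span ⟨0, rfl⟩)))
      refine hf.mem_Ann (e := 3) (e' := 0) (sub_mem hs (Submodule.smul_mem _ _ ht)) rfl
        fun a ha => ?_
      obtain rfl := (Finsupp.degree_eq_zero_iff a).1 ha
      rw [monomial_zero', C_1, mul_one, map_sub, map_smul, smul_eq_mul, inv_mul_cancel_right₀ hft,
        sub_self]
    · intro _ s hs
      simpa using mem_Ann_iff.1 hs 1
  · intro i hi
    rw [hilbert_eq_card (Ann f) i (fun e : Fin 0 => e.elim0) (fun e => e.elim0)
      (fun s hs => Submodule.mem_sup_left (hf.mem_Ann_of_lt hs hi)) (fun e => e.elim0)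
      (fun e => e.elim0) (by simp)]
    rfl
  · rw [hilbert_eq_card (Ann f ^ 2) 4 w (fun v => hw v) ?_
      (fun u => f.1 ∘ₗ (pderiv u).toLinearMap) (fun u s hs => apply_pderiv_eq_zero f u hs) hdet']
    · exact Fintype.card_fin n
    · refine h4.trans (sup_le_sup_right (Submodule.span_le.2 ?_) _)
      rintro _ ⟨p, rfl⟩
      exact hUU _ _ _ _
  · rw [hilbert_eq_card (Ann f ^ 2) 5 (fun e : Fin 0 => e.elim0) (fun e => e.elim0)
      ?_ (fun e => e.elim0) (fun e => e.elim0) (by simp)]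
    · rfl
    · refine (h5.trans (Submodule.span_le.2 ?_)).trans le_sup_left
      rintro _ ⟨p, rfl⟩
      exact Ideal.mul_mem_left _ _ (hUU _ _ _ _)

end Criterion

/-! ### The circulant cubic and its coefficients -/

section CirculantCubic

/-- The exponent of the monomial `xₐ x_b x_c`. -/
noncomputable def tripleExponent {n : ℕ} (a b c : Fin n) : Fin n →₀ ℕ :=
  Finsupp.single a 1 + Finsupp.single b 1 + Finsupp.single c 1

lemma tripleExponent_eq_iff {n : ℕ} {a b c x y z : Fin n} :
    tripleExponent a b c = tripleExponent x y z ↔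
      (a = x ∧ b = y ∧ c = z) ∨ (a = x ∧ b = z ∧ c = y) ∨ (a = y ∧ b = x ∧ c = z) ∨
      (a = y ∧ b = z ∧ c = x) ∨ (a = z ∧ b = x ∧ c = y) ∨ (a = z ∧ b = y ∧ c = x) := by
  constructor
  · intro h
    have h' := fun e => DFunLike.congr_fun h e
    simp only [tripleExponent, Finsupp.add_apply, Finsupp.single_apply] at h'
    have ha := h' a
    have hb := h' b
    have hc := h' c
    grind
  · rintro (⟨rfl, rfl, rfl⟩ | ⟨rfl, rfl, rfl⟩ | ⟨rfl, rfl, rfl⟩ | ⟨rfl, rfl, rfl⟩ |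
      ⟨rfl, rfl, rfl⟩ | ⟨rfl, rfl, rfl⟩) <;> simp only [tripleExponent] <;> abel

variable (n : ℕ) [NeZero n] (k : Type u) [Field k]

/-- The residue of an integer modulo `n`, as an index of a variable. -/
def residue (a : ℤ) : Fin n :=
  ⟨(a % n).toNat, by
    have := Int.emod_lt_of_pos a (show (0 : ℤ) < n by exact_mod_cast NeZero.pos n)
    have := Int.emod_nonneg a (show (n : ℤ) ≠ 0 by exact_mod_cast NeZero.ne n)
    omega⟩

variable {n} in
lemma residue_eq_iff {a b : ℤ} : residue n a = residue n b ↔ (n : ℤ) ∣ b - a := by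
  have ha := Int.emod_nonneg a (show (n : ℤ) ≠ 0 by exact_mod_cast NeZero.ne n)
  have hb := Int.emod_nonneg b (show (n : ℤ) ≠ 0 by exact_mod_cast NeZero.ne n)
  rw [residue, residue, Fin.mk.injEq, ← Int.modEq_iff_dvd, Int.ModEq]
  omega

variable {n} in
lemma residue_coe (i : Fin n) : residue n (i : ℤ) = i := by
  apply Fin.ext
  have := i.2
  have h : (i : ℤ) % n = i := Int.emod_eq_of_lt (by omega) (by omega)
  simp [residue, h]

/-- The cubic `∑ xᵢ xᵢ₊₁ xᵢ₊₃`, with indices modulo `n`. -/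
noncomputable def circulantCubic : P n k :=
  ∑ a ∈ Finset.univ.image fun i : Fin n =>
    tripleExponent i (residue n (i + 1)) (residue n (i + 3)), dpMonomial a

lemma circulantCubic_isHomogeneous : IsHomogeneousOfDegree (circulantCubic n k) 3 := by
  refine sum_mem fun a ha => Submodule.subset_span ⟨a, ?_, rfl⟩
  obtain ⟨i, -, rfl⟩ := Finset.mem_image.1 ha
  simp [tripleExponent, Finsupp.degree_single]

variable {n}

/-- `a`, `b`, `c` are the residues of `i`, `i + 1`, `i + 3`, in some order. -/
def IsTriple (a b c : Fin n) : Prop :=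
  ∃ i : ℤ, tripleExponent a b c =
    tripleExponent (residue n i) (residue n (i + 1)) (residue n (i + 3))

-- The cubic is a sum over a set of exponents rather than over indices, so every coefficient is 0 or
-- 1 without checking that different i give different monomials.
open Classical in
lemma circulantCubic_apply (a b c : Fin n) :
    (circulantCubic n k).1 (X a * (X b * X c)) = if IsTriple a b c then 1 else 0 := by
  have hmon : (X a * (X b * X c) : S n k) = monomial (tripleExponent a b c) 1 := by
    simp [X, monomial_mul, tripleExponent, add_assoc]
  have hsum : (circulantCubic n k).1 (X a * (X b * X c)) = ∑ e ∈ Finset.univ.image fun i : Fin n =>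
      tripleExponent i (residue n (i + 1)) (residue n (i + 3)),
        coeff e (X a * (X b * X c) : S n k) := by
    rw [circulantCubic, AddSubmonoidClass.coe_finsetSum, LinearMap.sum_apply]
    rfl
  rw [hsum, hmon]
  simp only [coeff_monomial]
  rw [Finset.sum_ite_eq]
  congr 1
  rw [eq_iff_iff, Finset.mem_image]
  constructor
  · rintro ⟨i, -, h⟩
    exact ⟨i, by rw [residue_coe]; exact h.symm⟩
  · rintro ⟨i, h⟩
    refine ⟨residue n i, Finset.mem_univ _, ?_⟩
    rw [h]
    have hi : (n : ℤ) ∣ i - (residue n i : ℕ) := by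
      rw [← residue_eq_iff, residue_coe]
    congr 1 <;> rw [residue_eq_iff] <;> ring_nf <;> ring_nf at hi <;> assumption

lemma dvd_sub_of_residue_eq {a b u v : ℤ} (ha : residue n a = residue n u)
    (hb : residue n b = residue n v) : (n : ℤ) ∣ b - a - (v - u) := by
  rw [residue_eq_iff] at ha hb
  have := dvd_sub ha hb
  rwa [show u - a - (v - b) = b - a - (v - u) by ring] at this

lemma not_isTriple_of_not_adj {a b : ℤ} (h : ¬ Adj n a b) (c : Fin n) :
    ¬ IsTriple c (residue n a) (residue n b) := by
  rintro ⟨i, hi⟩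
  rw [tripleExponent_eq_iff] at hi
  have key : ∀ u v : ℤ, residue n a = residue n u → residue n b = residue n v →
      v - u ∉ [-3, -2, -1, 1, 2, (3 : ℤ)] := fun u v ha hb he =>
    h ⟨v - u, he, dvd_sub_of_residue_eq ha hb⟩
  rcases hi with ⟨-, h1, h2⟩ | ⟨-, h1, h2⟩ | ⟨-, h1, h2⟩ | ⟨-, h1, h2⟩ | ⟨-, h1, h2⟩ | ⟨-, h1, h2⟩ <;>
    exact key _ _ h1 h2 (by simp only [List.mem_cons, List.not_mem_nil, or_false]; omega)

/-- The six differences ±1, ±2, ±3 within a triple are distinct and stay distinct modulo n, so an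
adjacent pair determines its triple and hence the third vertex. -/
lemma isTriple_iff_of_mem_link (hn : 18 ≤ n) {p c : ℤ} {l : ℤ × ℤ} (hl : l ∈ link p) :
    IsTriple (residue n c) (residue n l.1) (residue n l.2) ↔ residue n c = residue n p := by
  obtain ⟨l1, l2⟩ := l
  simp only [link, List.mem_cons, Prod.mk.injEq, List.not_mem_nil, or_false] at hl
  constructor
  · rintro ⟨i, hi⟩
    rw [tripleExponent_eq_iff] at hi
    have key : ∀ u v : ℤ, residue n l1 = residue n u → residue n l2 = residue n v →
        -3 ≤ v - u → v - u ≤ 3 → (n : ℤ) ∣ u - l1 ∧ l2 - l1 = v - u := fun u v ha hb h1 h2 => by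
      have := Int.eq_zero_of_abs_lt_dvd (dvd_sub_of_residue_eq ha hb) (by rw [abs_lt]; omega)
      exact ⟨residue_eq_iff.1 ha, by omega⟩
    rcases hi with ⟨h0, h1, h2⟩ | ⟨h0, h1, h2⟩ | ⟨h0, h1, h2⟩ | ⟨h0, h1, h2⟩ | ⟨h0, h1, h2⟩ |
      ⟨h0, h1, h2⟩ <;> obtain ⟨h3, h4⟩ := key _ _ h1 h2 (by omega) (by omega) <;>
      rw [h0, eq_comm, residue_eq_iff] <;>
      rcases hl with hl | hl | hl <;> first | omega | (convert h3 using 1; omega)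
  · intro h
    rw [h]
    rcases hl with ⟨rfl, rfl⟩ | ⟨rfl, rfl⟩ | ⟨rfl, rfl⟩
    · exact ⟨p, by rw [tripleExponent_eq_iff]; simp⟩
    · exact ⟨p - 1, by rw [tripleExponent_eq_iff]; simp [show p - 1 + 3 = p + 2 by ring]⟩
    · exact ⟨p - 3, by rw [tripleExponent_eq_iff]; simp [show p - 3 + 1 = p - 2 by ring]⟩

end CirculantCubic

/-! ### The open conditions hold for the circulant cubic -/

section CirculantConditions

variable {n : ℕ} [NeZero n]

/-- The quadric `x_{r-3} x_{r-2}`, which together with `x_r` forms a monomial of the circulant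
cubic. -/
noncomputable def vertexQuadric (A : Type*) [CommRing A] (r : Fin n) : MvPolynomial (Fin n) A :=
  X (residue n (r - 3)) * X (residue n (r - 2))

/-- The product of `x_v` and a monomial of the circulant cubic remote from `v`. -/
noncomputable def vertexQuartic (A : Type*) [CommRing A] (v : Fin n) : MvPolynomial (Fin n) A :=
  X v * (X (residue n (v + 7)) * (X (residue n (v + 8)) * X (residue n (v + 10))))

lemma vertexQuadric_isHomogeneous (A : Type*) [CommRing A] (r : Fin n) :
    (vertexQuadric A r).IsHomogeneous 2 :=
  (isHomogeneous_X A _).mul (isHomogeneous_X A _)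

lemma vertexQuartic_isHomogeneous (A : Type*) [CommRing A] (v : Fin n) :
    (vertexQuartic A v).IsHomogeneous 4 :=
  (isHomogeneous_X A _).mul
    ((isHomogeneous_X A _).mul ((isHomogeneous_X A _).mul (isHomogeneous_X A _)))

lemma map_vertexQuadric {A B : Type*} [CommRing A] [CommRing B] (φ : A →+* B) (r : Fin n) :
    map φ (vertexQuadric A r) = vertexQuadric B r := by
  simp [vertexQuadric]

lemma map_vertexQuartic {A B : Type*} [CommRing A] [CommRing B] (φ : A →+* B) (r : Fin n) :
    map φ (vertexQuartic A r) = vertexQuartic B r := by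
  simp [vertexQuartic]

variable (k : Type u) [Field k]

/-- The variable with index the residue of an integer. -/
noncomputable def circVar (a : ℤ) : S n k := X (residue n a)

variable {k}

lemma circVar_coe (a : Fin n) : circVar k (a : ℤ) = X a := by
  rw [circVar, residue_coe]

lemma circVar_eq {a b : ℤ} (h : (n : ℤ) ∣ b - a) : circVar (n := n) k b = circVar k a := by
  rw [circVar, circVar, residue_eq_iff.2 h]

lemma apply_of_not_adj {a b : ℤ} (h : ¬ Adj n a b) (c : ℤ) :
    (circulantCubic n k).1 (circVar k c * (circVar k a * circVar k b)) = 0 := by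
  rw [circVar, circVar, circVar, circulantCubic_apply, if_neg (not_isTriple_of_not_adj h _)]

lemma apply_of_mem_link (hn : 18 ≤ n) {p : ℤ} {l : ℤ × ℤ} (hl : l ∈ link p) (c : ℤ) :
    (circulantCubic n k).1 (circVar k c * (circVar k l.1 * circVar k l.2)) =
      if residue n c = residue n p then 1 else 0 := by
  rw [circVar, circVar, circVar, circulantCubic_apply]
  simp only [isTriple_iff_of_mem_link hn hl]

lemma vertexQuadric_residue (p : ℤ) :
    vertexQuadric k (residue n p) = circVar k (p - 3) * circVar k (p - 2) := by
  have hp : (n : ℤ) ∣ (residue n p : ℕ) - p := by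
    rw [← residue_eq_iff, residue_coe]
  rw [vertexQuadric]
  congr 1 <;> apply circVar_eq <;> convert hp using 1 <;> ring

/-- The only vertex completing {r - 3, r - 2} to a triple is r, so these quadrics are dual to the
variables. -/
lemma pairingMatrix_circulantCubic (hn : 18 ≤ n) :
    pairingMatrix (vertexQuadric k) (circulantCubic n k).1 = 1 := by
  ext s r
  change (circulantCubic n k).1 (X s * vertexQuadric k r) = _
  rw [← circVar_coe, ← residue_coe r, vertexQuadric_residue,
    apply_of_mem_link hn (p := (r : ℤ)) (l := (_, _)) (by simp [link])]
  simp [residue_coe, Matrix.one_apply]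

lemma cramerQuadric_circulantCubic (hn : 18 ≤ n) (q : S n k) :
    cramerQuadric (vertexQuadric k) (circulantCubic n k).1 q =
      q - ∑ r, (circulantCubic n k).1 (X r * q) • vertexQuadric k r := by
  rw [cramerQuadric, pairingMatrix_circulantCubic hn, Matrix.det_one, Matrix.adjugate_one,
    Matrix.one_mulVec, one_smul]

lemma cramerQuadric_of_not_adj (hn : 18 ≤ n) {a b : ℤ} (h : ¬ Adj n a b) :
    cramerQuadric (vertexQuadric k) (circulantCubic n k).1 (circVar k a * circVar k b) =
      circVar k a * circVar k b := by
  rw [cramerQuadric_circulantCubic hn, sub_eq_self]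
  refine Finset.sum_eq_zero fun r _ => ?_
  rw [← circVar_coe, apply_of_not_adj h, zero_smul]

lemma cramerQuadric_of_mem_link (hn : 18 ≤ n) {p : ℤ} {l : ℤ × ℤ} (hl : l ∈ link p) :
    cramerQuadric (vertexQuadric k) (circulantCubic n k).1 (circVar k l.1 * circVar k l.2) =
      circVar k l.1 * circVar k l.2 - vertexQuadric k (residue n p) := by
  rw [cramerQuadric_circulantCubic hn]
  congr 1
  simp only [← circVar_coe, apply_of_mem_link hn hl, residue_coe]
  simp

variable (n k) in
/-- The quadrics annihilating the circulant cubic. -/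
noncomputable def circulantQuadrics : Submodule k (S n k) :=
  Submodule.span k (Set.range fun p : Fin n × Fin n =>
    cramerQuadric (vertexQuadric k) (circulantCubic n k).1 (X p.1 * X p.2))

lemma circulantQuadrics_le_Ann {q : S n k} (hq : q ∈ circulantQuadrics n k) :
    q ∈ Ann (circulantCubic n k) := by
  have : circulantQuadrics n k ≤ (Ann (circulantCubic n k)).restrictScalars k := by
    rw [circulantQuadrics, Submodule.span_le]
    rintro _ ⟨p, rfl⟩
    exact (circulantCubic_isHomogeneous n k).mem_Ann_of_quadric
      (cramerQuadric_isHomogeneous (vertexQuadric_isHomogeneous k) _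
        ((isHomogeneous_X k _).mul (isHomogeneous_X k _))) (apply_X_mul_cramerQuadric _ _ _)
  exact this hq

lemma circulantSystem (hn : 18 ≤ n) :
    CirculantSystem n (circVar k) (circulantQuadrics n k : Set (S n k))
      (circulantQuadrics n k * circulantQuadrics n k ⊔
        Submodule.span k (Set.range (vertexQuartic k))).toAddSubgroup where
  le := hn
  periodic _ _ h := circVar_eq h
  mul_mem q hq q' hq' := Submodule.mem_sup_left (Submodule.mul_mem_mul hq hq')
  of_not_adj a b h := by
    rw [← cramerQuadric_of_not_adj hn h]
    exact Submodule.subset_span ⟨(_, _), rfl⟩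
  exchange p l hl m hm := by
    have hmem : ∀ a b : Fin n, cramerQuadric (vertexQuadric k) (circulantCubic n k).1
        (X a * X b) ∈ circulantQuadrics n k := fun a b => Submodule.subset_span ⟨(a, b), rfl⟩
    have := sub_mem (hmem (residue n l.1) (residue n l.2)) (hmem (residue n m.1) (residue n m.2))
    have hl' := cramerQuadric_of_mem_link (k := k) hn hl
    have hm' := cramerQuadric_of_mem_link (k := k) hn hm
    simp only [circVar] at hl' hm'
    simp only [hl', hm', sub_sub_sub_cancel_right] at this
    exact this
  base v := by
    refine Submodule.mem_sup_right (Submodule.subset_span ⟨residue n v, ?_⟩)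
    have hv : (n : ℤ) ∣ (residue n v : ℕ) - v := by
      rw [← residue_eq_iff, residue_coe]
    have hX : ∀ j : ℤ, (X (residue n ((residue n v : ℕ) + j)) : S n k) = circVar k (v + j) :=
      fun j => circVar_eq (by simpa using hv)
    rw [vertexQuartic, hX, hX, hX, mul_assoc (circVar k (v + 7))]
    rfl

theorem homogeneousSubmodule_four_le (hn : 18 ≤ n) : homogeneousSubmodule (Fin n) k 4 ≤
    circulantQuadrics n k * circulantQuadrics n k ⊔
      Submodule.span k (Set.range (vertexQuartic k)) := by
  refine homogeneousSubmodule_le_of_prod_mem _ _ fun v => ?_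
  have := (circulantSystem (k := k) hn).mul_mem_all (v 0) (v 1) (v 2) (v 3)
  simp only [circVar_coe] at this
  rw [Fin.prod_univ_four, mul_assoc]
  exact this

lemma apply_pderiv_mul (f : S n k →ₗ[k] k) (u : Fin n) (a b c d : ℤ) :
    f (pderiv u (circVar k a * (circVar k b * (circVar k c * circVar k d)))) =
      (if residue n a = u then f (circVar k b * (circVar k c * circVar k d)) else 0) +
      (if residue n b = u then f (circVar k a * (circVar k c * circVar k d)) else 0) +
      (if residue n c = u then f (circVar k a * (circVar k b * circVar k d)) else 0) +
      (if residue n d = u then f (circVar k a * (circVar k b * circVar k c)) else 0) := by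
  have h : ∀ a : ℤ, pderiv u (circVar k a : S n k) = if residue n a = u then 1 else 0 := by
    intro a
    rw [circVar, pderiv_X, Pi.single_apply]
  simp only [Derivation.leibniz, h, smul_eq_mul, map_add, mul_add]
  split_ifs <;> simp <;> ring_nf

lemma vertexQuartic_eq (v : Fin n) : vertexQuartic k v = circVar k v * (circVar k (v + 7) *
    (circVar k (v + 8) * circVar k (v + 10))) := by
  rw [circVar_coe]; rfl

omit [NeZero n] in
lemma not_adj_of_sub_mem (hn : 18 ≤ n) {a b : ℤ} (h : 4 ≤ b - a) (h' : b - a ≤ 14) :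
    ¬ Adj n a b :=
  CirculantSystem.not_adj_of_le_sub h (by omega)

/-- Only deleting x_v leaves a monomial of the cubic; any other deletion keeps x_v beside a vertex
not adjacent to v. -/
lemma apply_pderiv_vertexQuartic (hn : 18 ≤ n) (u v : Fin n) :
    (circulantCubic n k).1 (pderiv u (vertexQuartic k v)) = if v = u then 1 else 0 := by
  have h7 : ¬ Adj n (v : ℤ) (v + 7) := not_adj_of_sub_mem hn (by omega) (by omega)
  have h8 : ¬ Adj n (v : ℤ) (v + 8) := not_adj_of_sub_mem hn (by omega) (by omega)
  have h10 : ¬ Adj n (v : ℤ) (v + 10) := not_adj_of_sub_mem hn (by omega) (by omega)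
  have h1 := apply_of_not_adj (k := k) h8 (v + 10)
  have h2 := apply_of_not_adj (k := k) h7 (v + 10)
  have h3 := apply_of_not_adj (k := k) h7 (v + 8)
  have h0 := apply_of_mem_link (k := k) hn (p := (v : ℤ) + 7) (l := (v + 8, v + 10))
    (by simp [link]; omega) (v + 7)
  rw [if_pos rfl] at h0
  rw [vertexQuartic_eq, apply_pderiv_mul, h0, residue_coe]
  rw [show (circVar k (v : ℤ) * (circVar k (v + 8) * circVar k (v + 10)) : S n k) =
    circVar k (v + 10) * (circVar k v * circVar k (v + 8)) by ring, h1,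
    show (circVar k (v : ℤ) * (circVar k (v + 7) * circVar k (v + 10)) : S n k) =
    circVar k (v + 10) * (circVar k v * circVar k (v + 7)) by ring, h2,
    show (circVar k (v : ℤ) * (circVar k (v + 7) * circVar k (v + 8)) : S n k) =
    circVar k (v + 8) * (circVar k v * circVar k (v + 7)) by ring, h3]
  simp

/-- The functionals `x_u f` detect the products of quadrics annihilating the circulant cubic. -/
lemma mem_mul_of_apply_pderiv_eq_zero (hn : 18 ≤ n) {m : S n k}
    (hm : m ∈ homogeneousSubmodule (Fin n) k 4)
    (h : ∀ u, (circulantCubic n k).1 (pderiv u m) = 0) :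
    m ∈ circulantQuadrics n k * circulantQuadrics n k := by
  obtain ⟨y, hy, z, hz, rfl⟩ := Submodule.mem_sup.1 (homogeneousSubmodule_four_le hn hm)
  obtain ⟨c, rfl⟩ := (Submodule.mem_span_range_iff_exists_fun k).1 hz
  have hy0 : ∀ u, (circulantCubic n k).1 (pderiv u y) = 0 := by
    intro u
    refine apply_pderiv_eq_zero _ u ?_
    rw [pow_two]
    refine Submodule.mul_induction_on hy (fun p hp q hq => ?_) fun _ _ => add_mem
    exact Ideal.mul_mem_mul (circulantQuadrics_le_Ann hp) (circulantQuadrics_le_Ann hq)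
  have hc : ∀ u, c u = 0 := by
    intro u
    have := h u
    simpa [map_add, hy0, map_sum, apply_pderiv_vertexQuartic hn] using this
  simpa [hc] using hy

lemma circVar_isHomogeneous (a : ℤ) : (circVar k a : S n k).IsHomogeneous 1 :=
  isHomogeneous_X k _

/-- Regroup the quintic as a variable times a quartic containing xᵢ x_v on which all functionals x_u
f vanish; that quartic lies in Q·Q. -/
lemma X_mul_vertexQuartic_mem (hn : 18 ≤ n) (i v : Fin n)
    (W : Submodule k (S n k))
    (hW : ∀ t : Fin n, ∀ m ∈ circulantQuadrics n k * circulantQuadrics n k, X t * m ∈ W) :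
    X i * vertexQuartic k v ∈ W := by
  have hadj : ∀ j : ℤ, 4 ≤ j → j ≤ 14 → ∀ c : ℤ, (circulantCubic n k).1 (circVar k c *
      (circVar k v * circVar k (v + j))) = 0 := fun j h h' c =>
    apply_of_not_adj (not_adj_of_sub_mem hn (by omega) (by omega)) c
  have key : ∀ p : ℤ, ∀ l ∈ [((8 : ℤ), (10 : ℤ)), (7, 10)], (v + l.1, v + l.2) ∈ link p →
      residue n i ≠ residue n p →
      circVar k i * (circVar k v * (circVar k (v + l.1) * circVar k (v + l.2))) ∈
        circulantQuadrics n k * circulantQuadrics n k := by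
    intro p l hl hlp hip
    have hl1 : 4 ≤ l.1 ∧ l.1 ≤ 14 ∧ 4 ≤ l.2 ∧ l.2 ≤ 14 := by
      simp only [List.mem_cons, List.not_mem_nil, or_false] at hl
      rcases hl with rfl | rfl <;> norm_num
    have h1 := hadj l.1 hl1.1 hl1.2.1
    have h2 := hadj l.2 hl1.2.2.1 hl1.2.2.2
    have h3 := apply_of_mem_link (k := k) hn hlp i
    rw [if_neg hip] at h3
    refine mem_mul_of_apply_pderiv_eq_zero hn ((circVar_isHomogeneous _).mul
      ((circVar_isHomogeneous _).mul ((circVar_isHomogeneous _).mul (circVar_isHomogeneous _))))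
      fun u => ?_
    rw [apply_pderiv_mul, h3, h1, h2, show (circVar k (v : ℤ) * (circVar k (v + l.1) *
      circVar k (v + l.2)) : S n k) = circVar k (v + l.2) * (circVar k v * circVar k (v + l.1)) by
        ring, h1]
    simp
  rw [vertexQuartic_eq, ← circVar_coe i]
  -- Pulling out x_{v+7} leaves xᵢ x_v x_{v+8} x_{v+10}, which is killed unless i completes {v + 8,
  -- v + 10}, that is i = v + 7. In that case x_{v+8} is pulled out instead.
  by_cases h : residue n (i : ℤ) = residue n (v + 7)
  · have h' : residue n (i : ℤ) ≠ residue n (v + 8) := by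
      rw [h, Ne, residue_eq_iff]
      intro h1
      have := Int.eq_zero_of_abs_lt_dvd h1 (by rw [abs_lt]; omega)
      omega
    convert hW (residue n (v + 8)) _ (key (v + 8) (7, 10) (by simp) (by simp [link]; omega) h')
      using 1
    change _ = circVar k _ * _
    ring
  · convert hW (residue n (v + 7)) _ (key (v + 7) (8, 10) (by simp) (by simp [link]; omega) h)
      using 1
    change _ = circVar k _ * _
    ring

theorem homogeneousSubmodule_five_le (hn : 18 ≤ n) (W : Submodule k (S n k))
    (hW : ∀ t : Fin n, ∀ m ∈ circulantQuadrics n k * circulantQuadrics n k, X t * m ∈ W) :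
    homogeneousSubmodule (Fin n) k 5 ≤ W := by
  refine homogeneousSubmodule_le_of_prod_mem _ _ fun v => ?_
  rw [Fin.prod_univ_succ]
  have hmem : ∏ i : Fin 4, X (v i.succ) ∈ homogeneousSubmodule (Fin n) k 4 := by
    have := IsHomogeneous.prod Finset.univ (fun i : Fin 4 => (X (v i.succ) : S n k)) (fun _ => 1)
      fun i _ => isHomogeneous_X k _
    simpa using this
  obtain ⟨y, hy, z, hz, h⟩ := Submodule.mem_sup.1 (homogeneousSubmodule_four_le hn hmem)
  obtain ⟨c, rfl⟩ := (Submodule.mem_span_range_iff_exists_fun k).1 hz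
  rw [← h, mul_add, Finset.mul_sum]
  refine add_mem (hW _ _ hy) (sum_mem fun u _ => ?_)
  rw [mul_smul_comm]
  exact W.smul_mem _ (X_mul_vertexQuartic_mem hn _ _ W hW)

end CirculantConditions

/-! ### The universal cubic and descent to an open set -/

section UniversalCubic

variable (n : ℕ) (k : Type u) [Field k]

/-- The coordinate ring of the affine space of cubics. -/
abbrev CubicRing : Type u := MvPolynomial {a : Fin n →₀ ℕ // a.degree = 3} k

open Classical in
/-- The universal cubic, as a functional on the polynomial ring over the coordinate ring of the
affine space of cubics. -/
noncomputable def universalCubic :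
    MvPolynomial (Fin n) (CubicRing n k) →ₗ[CubicRing n k] CubicRing n k :=
  (basisMonomials (Fin n) (CubicRing n k)).constr (CubicRing n k) fun a =>
    if h : a.degree = 3 then X ⟨a, h⟩ else 0

variable {n k} {K : Type u} [Field K] [Algebra k K]

variable (k) in
/-- Evaluation of polynomials in the coefficients of a cubic. -/
noncomputable def evalCubic (f : P n K) : CubicRing n k →ₐ[k] K :=
  aeval fun a : {a : Fin n →₀ ℕ // a.degree = 3} => f.1 (monomial a.1 (1 : K))

lemma evalCubic_universalCubic {f : P n K} (hf : IsHomogeneousOfDegree f 3)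
    (p : MvPolynomial (Fin n) (CubicRing n k)) :
    (evalCubic k f : CubicRing n k →+* K) (universalCubic n k p) =
      f.1 (map (evalCubic k f : CubicRing n k →+* K) p) := by
  induction p using MvPolynomial.induction_on' with
  | monomial a c =>
    have h1 : universalCubic n k (monomial a 1) = if h : a.degree = 3 then X ⟨a, h⟩ else 0 := by
      have := (basisMonomials (Fin n) (CubicRing n k)).constr_basis (CubicRing n k)
        (fun a => if h : a.degree = 3 then (X ⟨a, h⟩ : CubicRing n k) else 0) a
      rw [coe_basisMonomials] at this
      rw [universalCubic]
      convert this
    have h2 : (monomial a c : MvPolynomial (Fin n) (CubicRing n k)) = c • monomial a 1 := by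
      rw [smul_monomial, smul_eq_mul, mul_one]
    have h3 : ∀ r : K, f.1 (monomial a r) = r * f.1 (monomial a 1) := by
      intro r
      rw [← smul_eq_mul, ← map_smul, smul_monomial, smul_eq_mul, mul_one]
    rw [map_monomial, h3, h2, map_smul, h1, smul_eq_mul, map_mul]
    congr 1
    split_ifs with h
    · simp [evalCubic]
    · rw [map_zero, hf.apply_monomial h]
  | add p q hp hq => simp only [map_add, hp, hq]

end UniversalCubic

/-- The conditions of `smallTangentSpace_of_span` define a nonempty open subset of the space of
cubics. -/
theorem exists_polynomial_smallTangentSpace (k : Type u) [Field k] (n : ℕ) (hn : 18 ≤ n) :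
    ∃ D : CubicRing n k,
      (∃ f : P n k, IsHomogeneousOfDegree f 3 ∧ evalCubic k f D ≠ 0) ∧
      ∀ (K : Type u) [Field K] [Algebra k K] (f : P n K), IsHomogeneousOfDegree f 3 →
        evalCubic k f D ≠ 0 → SmallTangentSpace f := by
  have : NeZero n := ⟨by omega⟩
  let A := CubicRing n k
  let l := universalCubic n k
  let q : Fin n × Fin n → MvPolynomial (Fin n) A := fun p =>
    cramerQuadric (vertexQuadric A) l (X p.1 * X p.2)
  have hq : ∀ p, (q p).IsHomogeneous 2 := fun p =>
    cramerQuadric_isHomogeneous (vertexQuadric_isHomogeneous A) _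
      ((isHomogeneous_X A _).mul (isHomogeneous_X A _))
  let F₄ : ((Fin n × Fin n) × (Fin n × Fin n)) ⊕ Fin n → MvPolynomial (Fin n) A :=
    Sum.elim (fun p => q p.1 * q p.2) (vertexQuartic A)
  let F₅ : Fin n × (Fin n × Fin n) × (Fin n × Fin n) → MvPolynomial (Fin n) A :=
    fun p => X p.1 * (q p.2.1 * q p.2.2)
  let M : Matrix (Fin n) (Fin n) A := Matrix.of fun u v => l (pderiv u (vertexQuartic A v))
  let f₀ := circulantCubic n k
  have hf₀ : IsHomogeneousOfDegree f₀ 3 := circulantCubic_isHomogeneous n k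
  have mapq : ∀ (K : Type u) [Field K] [Algebra k K] (f : P n K), IsHomogeneousOfDegree f 3 →
      ∀ p, map (evalCubic k f : A →+* K) (q p) =
        cramerQuadric (vertexQuadric K) f.1 (X p.1 * X p.2) := by
    intro K _ _ f hf p
    rw [cramerQuadric_map _ (map_vertexQuadric _) (evalCubic_universalCubic hf)]
    simp
  have map₄ : ∀ (K : Type u) [Field K] [Algebra k K] (f : P n K), IsHomogeneousOfDegree f 3 →
      Submodule.span K (Set.range fun i => map (evalCubic k f : A →+* K) (F₄ i)) =
      Submodule.span K (Set.range fun p : (Fin n × Fin n) × (Fin n × Fin n) =>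
        cramerQuadric (vertexQuadric K) f.1 (X p.1.1 * X p.1.2) *
          cramerQuadric (vertexQuadric K) f.1 (X p.2.1 * X p.2.2)) ⊔
      Submodule.span K (Set.range (vertexQuartic K)) := by
    intro K _ _ f hf
    rw [← Submodule.span_union, ← Set.Sum.elim_range]
    congr 2
    funext i
    rcases i with p | v
    · simp only [F₄, Sum.elim_inl, map_mul, mapq K f hf]
    · simp only [F₄, Sum.elim_inr, map_vertexQuartic]
  have map₅ : ∀ (K : Type u) [Field K] [Algebra k K] (f : P n K), IsHomogeneousOfDegree f 3 →
      (fun i => map (evalCubic k f : A →+* K) (F₅ i)) =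
      fun p => X p.1 * (cramerQuadric (vertexQuadric K) f.1 (X p.2.1.1 * X p.2.1.2) *
          cramerQuadric (vertexQuadric K) f.1 (X p.2.2.1 * X p.2.2.2)) := by
    intro K _ _ f hf
    funext p
    simp only [F₅, map_mul, map_X, mapq K f hf]
  have mapM : ∀ (K : Type u) [Field K] [Algebra k K] (f : P n K), IsHomogeneousOfDegree f 3 →
      evalCubic k f M.det = (Matrix.of fun u v => f.1 (pderiv u (vertexQuartic K v))).det := by
    intro K _ _ f hf
    change (evalCubic k f : A →+* K) M.det = _
    rw [RingHom.map_det]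
    congr 1
    ext u v
    change (evalCubic k f : A →+* K) (l (pderiv u (vertexQuartic A v))) = _
    rw [evalCubic_universalCubic hf, ← pderiv_map, map_vertexQuartic]
    rfl
  have mapN : ∀ (K : Type u) [Field K] [Algebra k K] (f : P n K), IsHomogeneousOfDegree f 3 →
      evalCubic k f (pairingMatrix (vertexQuadric A) l).det =
        (pairingMatrix (vertexQuadric K) f.1).det := by
    intro K _ _ f hf
    change (evalCubic k f : A →+* K) _ = _
    rw [RingHom.map_det, pairingMatrix_map _ (map_vertexQuadric _) (evalCubic_universalCubic hf)]
  have hmul : Submodule.span k (Set.range fun p : (Fin n × Fin n) × (Fin n × Fin n) =>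
        cramerQuadric (vertexQuadric k) f₀.1 (X p.1.1 * X p.1.2) *
          cramerQuadric (vertexQuadric k) f₀.1 (X p.2.1 * X p.2.2)) =
      circulantQuadrics n k * circulantQuadrics n k := by
    rw [circulantQuadrics, Submodule.span_mul_span]
    congr 1
    ext s
    simp only [Set.mem_range, Set.mem_mul, Prod.exists, f₀]
    constructor
    · rintro ⟨a, b, c, d, rfl⟩
      exact ⟨_, ⟨a, b, rfl⟩, _, ⟨c, d, rfl⟩, rfl⟩
    · rintro ⟨_, ⟨a, b, rfl⟩, _, ⟨c, d, rfl⟩, rfl⟩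
      exact ⟨a, b, c, d, rfl⟩
  obtain ⟨D₄, h₄, H₄⟩ := exists_ne_zero_of_span.{u} (evalCubic k f₀) 4 F₄
    (by
      rintro (p | v)
      · exact (hq _).mul (hq _)
      · exact vertexQuartic_isHomogeneous A v)
    (by
      rw [map₄ k f₀ hf₀, hmul]
      exact homogeneousSubmodule_four_le hn)
  obtain ⟨D₅, h₅, H₅⟩ := exists_ne_zero_of_span.{u} (evalCubic k f₀) 5 F₅
    (fun p => (isHomogeneous_X A _).mul ((hq _).mul (hq _)))
    (by
      rw [map₅ k f₀ hf₀]
      refine homogeneousSubmodule_five_le hn _ fun t m hm => ?_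
      rw [← hmul] at hm
      induction hm using Submodule.span_induction with
      | mem m hm =>
        obtain ⟨p, rfl⟩ := hm
        exact Submodule.subset_span ⟨(t, p), rfl⟩
      | zero => rw [mul_zero]; exact zero_mem _
      | add a b _ _ ha hb => rw [mul_add]; exact add_mem ha hb
      | smul r a _ ha => rw [mul_smul_comm]; exact Submodule.smul_mem _ _ ha)
  -- The factors control, in order, the duality between degrees 1 and 2, the independence of the n
  -- quartics modulo Ann(f)², and spanning in degrees 4 and 5. At f₀ the first two equal 1.
  refine ⟨(pairingMatrix (vertexQuadric A) l).det * M.det * D₄ * D₅, ⟨f₀, hf₀, ?_⟩, ?_⟩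
  · rw [map_mul, map_mul, map_mul, mapN k f₀ hf₀, mapM k f₀ hf₀,
      pairingMatrix_circulantCubic hn, Matrix.det_one]
    have : (Matrix.of fun u v => f₀.1 (pderiv u (vertexQuartic k v))) = 1 := by
      ext u v
      rw [Matrix.of_apply, apply_pderiv_vertexQuartic hn, Matrix.one_apply]
      simp only [eq_comm]
    rw [this, Matrix.det_one, one_mul, one_mul]
    exact mul_ne_zero h₄ h₅
  · intro K _ _ f hf hD
    rw [map_mul, map_mul, map_mul, mapN K f hf, mapM K f hf] at hD
    have hD₅ := right_ne_zero_of_mul hD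
    have hD₄ := right_ne_zero_of_mul (left_ne_zero_of_mul hD)
    have hD' := left_ne_zero_of_mul (left_ne_zero_of_mul hD)
    refine smallTangentSpace_of_span hf (vertexQuadric_isHomogeneous K)
      (vertexQuartic_isHomogeneous K) (left_ne_zero_of_mul hD') ?_ (right_ne_zero_of_mul hD') ?_
    · rw [← map₄ K f hf]
      exact H₄ K (evalCubic k f : A →+* K) hD₄
    · rw [← map₅ K f hf]
      exact H₅ K (evalCubic k f : A →+* K) hD₅

end Apolarity

theorem mainTheorem1 (k : Type u) [Field k] (n : ℕ) (hn : 18 ≤ n) :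
    ∃ U : Set (Apolarity.CubicSpace n k), IsOpen U ∧ Dense U ∧
      (∃ f : Apolarity.P n k,
        Apolarity.IsHomogeneousOfDegree f 3 ∧ Apolarity.cubicPoint k f ∈ U) ∧
      ∀ (K : Type u) [Field K] [Algebra k K] (f : Apolarity.P n K),
        Apolarity.IsHomogeneousOfDegree f 3 → Apolarity.cubicPoint k f ∈ U →
          Apolarity.SmallTangentSpace f := by
  obtain ⟨D, ⟨f, hf, hfD⟩, H⟩ := Apolarity.exists_polynomial_smallTangentSpace k n hn
  -- The point of f is the kernel of evaluation at f, so lying in the basic open set of D means by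
  -- definition D(f) ≠ 0. Density holds because affine space is irreducible.
  refine ⟨PrimeSpectrum.basicOpen D, (PrimeSpectrum.basicOpen D).isOpen, ?_, ⟨f, hf, hfD⟩,
    fun K _ _ f hf hfD => H K f hf hfD⟩
  exact (PrimeSpectrum.basicOpen D).isOpen.dense ⟨Apolarity.cubicPoint k f, hfD⟩
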